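/- Let $F$ be a field of characteristic zero with algebraic closure $\overline F$, and let $p\ge q\ge 1$ be integers. Put $\mathfrak g=\mathfrak{gl}_{p+q}$, $I_{p,q}=\operatorname{diag}(\mathbb 1_p,-\mathbb 1_q)$, and let $\theta$ denote conjugation by $I_{p,q}$ on $\mathrm{GL}_{p+q}$ and on $\mathfrak g$. Let $G(1)\subset \mathrm{GL}_{p+q}$ be the subgroup of $\theta$-invariants and $\mathfrak g(-1)$ the $(-1)$-eigenspace of $\theta$ on $\mathfrak g$; $G(1)$ acts on $\mathfrak g(-1)$ by conjugation. A Cartan subspace of $\mathfrak g(-1)$ is a maximal commutative subspace consisting of semisimple elements, and $\operatorname{rank}\theta$ is the common dimension of the Cartan subspaces. An element of $\mathfrak g(-1)(F)$ is relatively regular if its $G(1)(\overline F)$-orbit has maximal dimension among all $G(1)(\overline F)$-orbits in $\mathfrak g(-1)(\overline F)$. Let $$e=\begin{pmatrix}0&A\\ B&0\end{pmatrix}\in\mathfrak{gl}_{p+q}(F),\qquad A=\begin{pmatrix}\mathbb 1_q\\ \mathbf 0_{p-q,q}\end{pmatrix},\qquad B=\begin{pmatrix}\mathbf 0_{q,1}&\mathbb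 1_q&\mathbf 0_{q,p-q-1}\end{pmatrix},$$ where for $p=q$ the matrix $B$ is instead the $q\times q$ matrix $\epsilon_q$ with entries $1$ at the places $(i,i+1)$, $1\le i<q$, and $0$ elsewhere. Then $e$ lies in $\mathfrak g(-1)(F)$ and is nilpotent; its centralizer $\mathfrak g(-1)^e=\{X\in\mathfrak g(-1)(F): [e,X]=0\}$ has dimension $q$ over $F$; Cartan subspaces of $\mathfrak g(-1)(F)$ exist and all have dimension $q$, that is, $\operatorname{rank}\theta=q$; and $e$ is relatively regular. -/

import Mathlib

namespace SymGL

open Matrix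

/-- The algebra of square matrices of size `p + q`, cut into blocks of sizes `p` and `q`
(the Lie algebra `gl_{p+q}(K)`, with the commutator as bracket). -/
abbrev Mat (K : Type*) (p q : ℕ) : Type _ := Matrix (Fin p ⊕ Fin q) (Fin p ⊕ Fin q) K

/-- `I_{p,q} = diag(1_p, -1_q)`, as an element of `GL_{p+q}(K)`. -/
def signature (K : Type*) [Field K] (p q : ℕ) : GL (Fin p ⊕ Fin q) K where
  val := fromBlocks 1 0 0 (-1)
  inv := fromBlocks 1 0 0 (-1)
  val_inv := by simp [fromBlocks_multiply]
  inv_val := by simp [fromBlocks_multiply]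

/-- The involution `θ(g) = I_{p,q} g I_{p,q}⁻¹` of `GL_{p+q}(K)`. -/
def groupTheta (K : Type*) [Field K] (p q : ℕ) : MulAut (GL (Fin p ⊕ Fin q) K) :=
  MulAut.conj (signature K p q)

/-- The subgroup `G(1)(K)` of `θ`-invariants in `GL_{p+q}(K)`. -/
def groupOne (K : Type*) [Field K] (p q : ℕ) : Subgroup (GL (Fin p ⊕ Fin q) K) :=
  (groupTheta K p q).toMonoidHom.eqLocus (MonoidHom.id _)

/-- The involution `θ(X) = I_{p,q} X I_{p,q}⁻¹` of the Lie algebra `gl_{p+q}(K)`. -/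
def theta (K : Type*) [Field K] (p q : ℕ) : Mat K p q →ₗ[K] Mat K p q :=
  LinearMap.mulLeftRight K
    ((signature K p q : Mat K p q), ((signature K p q)⁻¹ : GL (Fin p ⊕ Fin q) K).val)

/-- The `(-1)`-eigenspace `g(-1)(K)` of `θ`. -/
def gMinus (K : Type*) [Field K] (p q : ℕ) : Submodule K (Mat K p q) :=
  Module.End.eigenspace (theta K p q) (-1)

/-- The centralizer `g(-1)^X` of `X` in `g(-1)`: the kernel on `g(-1)` of
`ad X`, which sends `Y` to `X * Y - Y * X`. -/
def centralizerMinus {K : Type*} [Field K] {p q : ℕ} (X : Mat K p q) :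
    Submodule K (Mat K p q) :=
  gMinus K p q ⊓ LinearMap.ker (LinearMap.mulLeft K X - LinearMap.mulRight K X)

/-- `t` is a commutative subspace of `g(-1)` consisting of semisimple elements. -/
structure IsToralSubspace {K : Type*} [Field K] {p q : ℕ} (t : Submodule K (Mat K p q)) :
    Prop where
  le_gMinus : t ≤ gMinus K p q
  commute : ∀ X ∈ t, ∀ Y ∈ t, X * Y = Y * X
  semisimple : ∀ X ∈ t, Module.End.IsSemisimple (Matrix.toLin' X)

/-- A Cartan subspace of `g(-1)`: a maximal commutative subspace of semisimple elements. -/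
def IsCartanSubspace {K : Type*} [Field K] {p q : ℕ} (t : Submodule K (Mat K p q)) : Prop :=
  Maximal IsToralSubspace t

/-- `rank θ = r` over `K`: Cartan subspaces exist and all of them have dimension `r`. -/
def HasRank (K : Type*) [Field K] (p q r : ℕ) : Prop :=
  (∃ t : Submodule K (Mat K p q), IsCartanSubspace t) ∧
    ∀ t : Submodule K (Mat K p q), IsCartanSubspace t → Module.finrank K t = r

/-- The orbit of `X` under the adjoint action of `G(1)(K)`, as a set of points of the affine
space of matrices. The point attached to a matrix is its family of entries. -/
def orbit {K : Type*} [Field K] {p q : ℕ} (X : Mat K p q) :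
    Set ((Fin p ⊕ Fin q) × (Fin p ⊕ Fin q) → K) :=
  {v | ∃ g ∈ groupOne K p q,
    v = fun ij => ((g : Mat K p q) * X * (g⁻¹ : GL (Fin p ⊕ Fin q) K).val) ij.1 ij.2}

/-- The dimension of the orbit of `X` (for `K` algebraically closed): the Krull dimension of
the coordinate ring of its Zariski closure. Orbits are open in their closure, so this is the
dimension of the orbit as a variety. -/
noncomputable def orbitDim {K : Type*} [Field K] {p q : ℕ} (X : Mat K p q) : WithBot ℕ∞ :=
  ringKrullDim (MvPolynomial ((Fin p ⊕ Fin q) × (Fin p ⊕ Fin q)) K ⧸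
    MvPolynomial.vanishingIdeal K (orbit X))

/-- For `F̄` an algebraic closure of `F`, a matrix over `F` is relatively regular if it lies in
`g(-1)` and its `G(1)(F̄)`-orbit has maximal dimension among all `G(1)(F̄)`-orbits in
`g(-1)(F̄)`. -/
def IsRelativelyRegular {F : Type*} [Field F] (Fbar : Type*) [Field Fbar] [Algebra F Fbar]
    {p q : ℕ} (X : Mat F p q) : Prop :=
  X.map (algebraMap F Fbar) ∈ gMinus Fbar p q ∧
    ∀ Y ∈ gMinus Fbar p q, orbitDim Y ≤ orbitDim (X.map (algebraMap F Fbar))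

/-- The element `e`. Its upper right `p × q` block is `1_q` above `p - q` zero rows. Its lower
left `q × p` block has its ones at the places `(i, i + 1)`: it is `(0_{q,1} | 1_q | 0)` if
`p > q`, and the regular nilpotent upper triangular Jordan block if `p = q`. -/
def e (K : Type*) [Field K] (p q : ℕ) : Mat K p q :=
  fromBlocks 0
    (Matrix.of fun i j => if (i : ℕ) = (j : ℕ) then 1 else 0)
    (Matrix.of fun i j => if (j : ℕ) = (i : ℕ) + 1 then 1 else 0)
    0

end SymGL

/-! Everything rests on one inequality: `dim g(-1)^X ≥ q` for all `X` in `g(-1)`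
(`le_finrank_centralizerMinus`). The odd powers `e, e^3, ..., e^(2q-1)` are independent elements of
`g(-1)`, so on the line through `e` and `X` a general point has `q` independent odd powers, which
commute with it; and the rank of `ad` at a general point is at least the rank at `X`. For `e` itself
equality holds, because a commuting element of `g(-1)` is determined by the first row of its upper
right block.

Relative regularity. Orbit dimension is `dim G(1)` minus the dimension of the stabilizer in `g(1)`,
the `θ`-fixed matrices (`orbitDim_eq`). The trace form pairs `[g(1), X]` with `g(-1)^X`, so `dim
g(1)^X - dim g(-1)^X` does not depend on `X` (`finrank_stabilizer_add`). Hence the largest orbits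
are those with the smallest `g(-1)^X`. The orbit formula is proved with function fields: the
coordinate ring of the orbit closure is the algebra `A` generated by the entries of `g Y g⁻¹` for a
generic `g`, and suitably chosen entries of `g`, as many as the dimension of the stabilizer, form a
transcendence basis of `K(g)` over `A`.

Rank. For commuting semisimple `t` in `g(-1)` some vector `w` of the first summand is killed by no
nonzero element of `t`, so `X ↦ X w` embeds `t` into the second summand and `dim t ≤ q`. A Cartan
subspace equals `g(-1)^X` for one of its elements `X`
(`IsCartanSubspace.exists_eq_centralizerMinus`), so its dimension is also at least `q`. -/

/-! ### Krull dimension and transcendence degree. -/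

/-- Incomparability makes contraction of primes strictly monotone; lying over and going up lift
chains from `R` to `S`. -/
theorem ringKrullDim_eq_of_isIntegral (R S : Type*) [CommRing R] [CommRing S] [Algebra R S]
    [Algebra.IsIntegral R S] [FaithfulSMul R S] : ringKrullDim S = ringKrullDim R := by
  apply le_antisymm
  · refine Order.krullDim_le_of_strictMono (PrimeSpectrum.comap (algebraMap R S)) ?_
    intro I J hIJ
    exact Ideal.IsIntegral.comap_lt_comap (R := R) (I := I.asIdeal) (J := J.asIdeal) hIJ
  · refine iSup_le fun l => ?_
    obtain ⟨P, -, hP, hPl⟩ := Ideal.exists_ideal_over_prime_of_isIntegral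
      l.head.asIdeal (⊥ : Ideal S) (by
        rw [Ideal.comap_bot_of_injective _ (FaithfulSMul.algebraMap_injective R S)]
        exact bot_le)
    have : P.LiesOver l.head.asIdeal := ⟨hPl.symm⟩
    obtain ⟨L, hL, -⟩ := Ideal.exists_ltSeries_of_hasGoingUp l P
    rw [← hL]
    exact Order.LTSeries.length_le_krullDim L

/-- Noether normalization: neither invariant changes in an integral extension, and both are the
number of variables for a polynomial ring. -/
theorem ringKrullDim_eq_trdeg (k A : Type*) [Field k] [CommRing A] [IsDomain A] [Algebra k A]
    [Algebra.FiniteType k A] : ringKrullDim A = (Cardinal.toNat (Algebra.trdeg k A) : ℕ) := by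
  obtain ⟨s, g, hg, hint⟩ := exists_integral_inj_algHom_of_fg k A
  let _ : Algebra (MvPolynomial (Fin s) k) A := g.toRingHom.toAlgebra
  have : IsScalarTower k (MvPolynomial (Fin s) k) A := IsScalarTower.of_algebraMap_eq
    fun x => (g.commutes x).symm
  have : Algebra.IsIntegral (MvPolynomial (Fin s) k) A := ⟨hint⟩
  have : FaithfulSMul (MvPolynomial (Fin s) k) A :=
    (faithfulSMul_iff_algebraMap_injective _ _).mpr hg
  rw [ringKrullDim_eq_of_isIntegral (MvPolynomial (Fin s) k) A]
  have h := lift_trdeg_add_eq k (MvPolynomial (Fin s) k) A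
  rw [trdeg_eq_zero (R := MvPolynomial (Fin s) k) (A := A),
    MvPolynomial.trdeg_of_isDomain] at h
  have h2 := congrArg Cardinal.toNat h
  simp at h2
  simp [← h2]

/-! ### Linear algebra over a subfield. -/

open Matrix

/-- A linear map between coordinate spaces over `E` that is defined over the intermediate field `k`
and injective on `k`-rational vectors has a left inverse defined over `k`. -/
theorem exists_rational_leftInverse {K E σ m : Type*} [Field K] [Field E] [Algebra K E]
    [Fintype σ] [DecidableEq σ] [Fintype m] [DecidableEq m] (k : IntermediateField K E)
    (f : (σ → E) →ₗ[E] (m → E)) (hf : ∀ s r, f (Pi.single s 1) r ∈ k)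
    (hinj : ∀ y : σ → E, (∀ s, y s ∈ k) → f y = 0 → y = 0) :
    ∃ g : (m → E) →ₗ[E] (σ → E), g ∘ₗ f = LinearMap.id ∧
      ∀ z : m → E, (∀ r, z r ∈ k) → ∀ s, g z s ∈ k := by
  let T : Matrix m σ k := of fun r s => ⟨f (Pi.single s 1) r, hf s r⟩
  have hT : LinearMap.toMatrix' f = T.map (algebraMap k E) := by
    ext r s
    simp [T, LinearMap.toMatrix'_apply]
  have hTinj : LinearMap.ker (Matrix.toLin' T) = ⊥ := by
    rw [LinearMap.ker_eq_bot']
    intro y hy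
    have h1 : f (algebraMap k E ∘ y) = 0 := by
      rw [← Matrix.toLin'_toMatrix' f, hT, Matrix.toLin'_apply]
      ext r
      have h2 := RingHom.map_mulVec (algebraMap k E) T y r
      rw [← h2, ← Matrix.toLin'_apply, hy]
      simp
    have h3 := hinj _ (fun s => (y s).2) h1
    ext s
    exact congrFun h3 s
  obtain ⟨S, hS⟩ := LinearMap.exists_leftInverse_of_injective _ hTinj
  have hS' : LinearMap.toMatrix' S * T = 1 := by
    have := congrArg LinearMap.toMatrix' hS
    rwa [LinearMap.toMatrix'_comp, LinearMap.toMatrix'_toLin', LinearMap.toMatrix'_id] at this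
  refine ⟨Matrix.toLin' ((LinearMap.toMatrix' S).map (algebraMap k E)), ?_, ?_⟩
  · conv_lhs => rw [← Matrix.toLin'_toMatrix' f, hT]
    rw [← Matrix.toLin'_mul, ← Matrix.map_mul, hS',
      Matrix.map_one _ (map_zero _) (map_one _), Matrix.toLin'_one]
  · intro z hz s
    rw [Matrix.toLin'_apply]
    exact sum_mem fun r _ => mul_mem (SetLike.coe_mem _) (hz r)

theorem mem_of_rational_system {K E σ m : Type*} [Field K] [Field E] [Algebra K E]
    [Fintype σ] [DecidableEq σ] [Fintype m] [DecidableEq m] (k : IntermediateField K E)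
    (f : (σ → E) →ₗ[E] (m → E)) (hf : ∀ s r, f (Pi.single s 1) r ∈ k)
    (hinj : ∀ y, f y = 0 → y = 0) (x : σ → E) (hx : ∀ r, f x r ∈ k) (s : σ) : x s ∈ k := by
  obtain ⟨g, hg, hgk⟩ := exists_rational_leftInverse k f hf fun y _ => hinj y
  rw [← LinearMap.id_apply (R := E) x, ← hg]
  exact hgk _ hx s

/-- A subspace of a coordinate space is isomorphic to a coordinate space on a subset of the
coordinates, by restriction. -/
theorem exists_coordinates {K σ : Type*} [Field K] [Fintype σ] (U : Submodule K (σ → K)) :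
    ∃ c : Fin (Module.finrank K U) → σ, (∀ y ∈ U, (∀ i, y (c i) = 0) → y = 0) ∧
      ∃ h : Fin (Module.finrank K U) → σ → K, (∀ i, h i ∈ U) ∧
        ∀ i j, h i (c j) = if j = i then 1 else 0 := by
  classical
  let v : σ → Module.Dual K U := fun s => (LinearMap.proj s).comp U.subtype
  -- An independent set of coordinate functions on `U` with the same span as all of them: it
  -- separates the points of `U`, so it has exactly `dim U` members.
  obtain ⟨κ, a, ha, hsp, hli⟩ := exists_linearIndependent' K v
  have : Finite κ := Finite.of_injective a ha
  have := Fintype.ofFinite κ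
  let ρ : U →ₗ[K] (κ → K) := LinearMap.pi fun i => v (a i)
  have hρ : ∀ y : U, (∀ i, (y : σ → K) (a i) = 0) → y = 0 := by
    intro y hy
    have h1 : ∀ φ ∈ Submodule.span K (Set.range (v ∘ a)), φ y = 0 := by
      intro φ hφ
      induction hφ using Submodule.span_induction with
      | mem φ hφ => obtain ⟨i, rfl⟩ := hφ; exact hy i
      | zero => rfl
      | add _ _ _ _ h1 h2 => simp [h1, h2]
      | smul c _ _ h => simp [h]
    ext s
    exact h1 (v s) (hsp ▸ Submodule.subset_span ⟨s, rfl⟩)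
  have hinj : Function.Injective ρ := by
    rw [injective_iff_map_eq_zero]
    exact fun y hy => hρ y fun i => congrFun hy i
  have hcard : Fintype.card κ = Module.finrank K U := by
    apply le_antisymm
    · rw [← Subspace.dual_finrank_eq]
      exact hli.fintype_card_le_finrank
    · have := LinearMap.finrank_le_finrank_of_injective hinj
      simpa using this
  have hbij : Function.Bijective ρ :=
    ⟨hinj, (LinearMap.injective_iff_surjective_of_finrank_eq_finrank (by simp [hcard])).mp hinj⟩
  let ε : Fin (Module.finrank K U) ≃ κ := (Fintype.equivFinOfCardEq hcard).symm
  choose h hh using fun i => hbij.2 (Pi.single (ε i) 1)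
  refine ⟨a ∘ ε, fun y hy h0 => ?_, fun i => h i, fun i => (h i).2, fun i j => ?_⟩
  · have := hρ ⟨y, hy⟩ fun i => by simpa using h0 (ε.symm i)
    exact congrArg Subtype.val this
  · have := congrFun (hh i) (ε j)
    simpa [ρ, v, Pi.single_apply] using this

/-! ### Block diagonal matrices and the group `G(1)`. -/

namespace SymGL

open Matrix

/-- The coordinates of a block diagonal matrix. -/
abbrev Coord (p q : ℕ) : Type := (Fin p × Fin p) ⊕ (Fin q × Fin q)

/-- The block diagonal matrix with given coordinates. -/
def blk {A : Type*} [CommRing A] {p q : ℕ} : (Coord p q → A) →ₗ[A] Mat A p q where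
  toFun x := fromBlocks (of fun i j => x (.inl (i, j))) 0 0 (of fun i j => x (.inr (i, j)))
  map_add' x y := by
    ext (i | i) (j | j) <;> simp
  map_smul' c x := by
    ext (i | i) (j | j) <;> simp

/-- The coordinates of the diagonal blocks of a matrix. -/
def coords {A : Type*} [CommRing A] {p q : ℕ} : Mat A p q →ₗ[A] (Coord p q → A) where
  toFun P := Sum.elim (fun ij => P (.inl ij.1) (.inl ij.2)) (fun ij => P (.inr ij.1) (.inr ij.2))
  map_add' x y := by
    ext (i | i) <;> simp
  map_smul' c x := by
    ext (i | i) <;> simp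

section Blocks

variable {A B : Type*} [CommRing A] [CommRing B] {p q : ℕ}

theorem blk_apply (x : Coord p q → A) : blk x =
    fromBlocks (of fun i j => x (.inl (i, j))) 0 0 (of fun i j => x (.inr (i, j))) := rfl

@[simp]
theorem coords_blk (x : Coord p q → A) : coords (blk x) = x := by
  ext (i | i) <;> simp [coords, blk_apply]

theorem blk_injective : Function.Injective (blk : (Coord p q → A) →ₗ[A] Mat A p q) :=
  Function.LeftInverse.injective coords_blk

theorem blk_coords_fromBlocks (P : Matrix (Fin p) (Fin p) A) (Q : Matrix (Fin q) (Fin q) A) :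
    blk (coords (fromBlocks P 0 0 Q)) = fromBlocks P 0 0 Q := by
  ext (i | i) (j | j) <;> simp [coords, blk_apply]

theorem blk_coords_one : blk (coords (1 : Mat A p q)) = 1 := by
  rw [← fromBlocks_one, blk_coords_fromBlocks]

theorem blk_coords_mul (x y : Coord p q → A) : blk (coords (blk x * blk y)) = blk x * blk y := by
  rw [blk_apply x, blk_apply y, fromBlocks_multiply]
  simp only [Matrix.zero_mul, Matrix.mul_zero, add_zero, zero_add]
  exact blk_coords_fromBlocks _ _

theorem map_blk (f : A →+* B) (x : Coord p q → A) : (blk x).map f = blk (f ∘ x) := by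
  ext (i | i) (j | j) <;> simp [blk_apply]

theorem coords_map (f : A →+* B) (P : Mat A p q) : coords (P.map f) = f ∘ coords P := by
  ext (i | i) <;> simp [coords]

theorem exists_blk_inverse {K : Type*} [Field K] {x : Coord p q → K} (hx : (blk x).det ≠ 0) :
    ∃ y : Coord p q → K, blk x * blk y = 1 ∧ blk y * blk x = 1 := by
  have hx' := hx
  rw [blk_apply, det_fromBlocks_zero₂₁] at hx'
  have h1 := isUnit_iff_ne_zero.mpr (left_ne_zero_of_mul hx')
  have h2 := isUnit_iff_ne_zero.mpr (right_ne_zero_of_mul hx')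
  have h : blk x * blk (coords (fromBlocks (of fun i j => x (.inl (i, j)))⁻¹ 0 0
      (of fun i j => x (.inr (i, j)))⁻¹)) = 1 := by
    rw [blk_coords_fromBlocks, blk_apply, fromBlocks_multiply]
    simp [Matrix.mul_nonsing_inv _ h1, Matrix.mul_nonsing_inv _ h2]
  exact ⟨_, h, mul_eq_one_comm.mp h⟩

end Blocks

theorem mem_groupOne_iff {K : Type*} [Field K] [CharZero K] {p q : ℕ}
    {g : GL (Fin p ⊕ Fin q) K} :
    g ∈ groupOne K p q ↔ ∃ x : Coord p q → K, (g : Mat K p q) = blk x := by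
  have h1 : g ∈ groupOne K p q ↔ (signature K p q : Mat K p q) * g = g * signature K p q := by
    change signature K p q * g * (signature K p q)⁻¹ = g ↔ _
    rw [mul_inv_eq_iff_eq_mul, Units.ext_iff]
    rfl
  rw [h1]
  constructor
  · intro h
    refine ⟨coords (g : Mat K p q), ?_⟩
    obtain ⟨P, Q, S, T, hg⟩ : ∃ P Q S T, (g : Mat K p q) = fromBlocks P Q S T :=
      ⟨_, _, _, _, (fromBlocks_toBlocks _).symm⟩
    rw [hg] at h ⊢
    have h2 : (signature K p q : Mat K p q) = fromBlocks 1 0 0 (-1) := rfl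
    rw [h2, fromBlocks_multiply, fromBlocks_multiply, fromBlocks_inj] at h
    simp only [Matrix.one_mul, Matrix.zero_mul, Matrix.mul_zero, Matrix.mul_one, add_zero,
      zero_add, Matrix.neg_mul, Matrix.mul_neg] at h
    obtain ⟨-, hQ, hS, -⟩ := h
    have hQ0 : Q = 0 := by ext i j; exact self_eq_neg.mp (congrFun₂ hQ i j)
    have hS0 : S = 0 := by ext i j; exact self_eq_neg.mp (congrFun₂ hS.symm i j)
    rw [hQ0, hS0, blk_coords_fromBlocks]
  · rintro ⟨x, hx⟩
    have h2 : (signature K p q : Mat K p q) = fromBlocks 1 0 0 (-1) := rfl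
    rw [hx, h2, blk_apply, fromBlocks_multiply, fromBlocks_multiply]
    simp

/-- The coordinates of the block diagonal matrices commuting with `Y`. -/
def stabilizer {K : Type*} [Field K] {p q : ℕ} (Y : Mat K p q) : Submodule K (Coord p q → K) :=
  LinearMap.ker ((LinearMap.mulRight K Y - LinearMap.mulLeft K Y) ∘ₗ blk)

theorem mem_stabilizer {K : Type*} [Field K] {p q : ℕ} {Y : Mat K p q} {x : Coord p q → K} :
    x ∈ stabilizer Y ↔ blk x * Y = Y * blk x := by
  simp [stabilizer, sub_eq_zero]

/-! ### The generic point of `G(1)` and the vanishing ideal of an orbit. -/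

section Generic

variable {K : Type*} [Field K] {p q : ℕ} {E : Type*} [Field E]
  [Algebra (MvPolynomial (Coord p q) K) E]

/-- The generic block diagonal matrix. -/
noncomputable def gen (K : Type*) [Field K] (p q : ℕ) (E : Type*) [Field E]
    [Algebra (MvPolynomial (Coord p q) K) E] : Coord p q → E :=
  fun s => algebraMap (MvPolynomial (Coord p q) K) E (MvPolynomial.X s)

/-- The determinant of the generic block diagonal matrix, as a polynomial. -/
noncomputable def genDet (K : Type*) [Field K] (p q : ℕ) : MvPolynomial (Coord p q) K :=
  (blk (MvPolynomial.X : Coord p q → MvPolynomial (Coord p q) K)).det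

theorem eval_genDet (x : Coord p q → K) : MvPolynomial.eval x (genDet K p q) = (blk x).det := by
  rw [genDet, RingHom.map_det, RingHom.mapMatrix_apply, map_blk]
  congr 2
  ext s
  simp

theorem genDet_ne_zero : genDet K p q ≠ 0 := by
  intro h
  have := eval_genDet (coords (1 : Mat K p q))
  rw [h, blk_coords_one] at this
  simp at this

theorem algebraMap_genDet : algebraMap _ E (genDet K p q) = (blk (gen K p q E)).det := by
  rw [genDet, RingHom.map_det, RingHom.mapMatrix_apply, map_blk]
  rfl

variable [IsFractionRing (MvPolynomial (Coord p q) K) E]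

theorem det_gen_ne_zero : (blk (gen K p q E)).det ≠ 0 := by
  rw [← algebraMap_genDet]
  exact (map_ne_zero_iff _ (IsFractionRing.injective _ _)).mpr genDet_ne_zero

end Generic

theorem det_mul_conj_apply {E : Type*} [Field E] {p q : ℕ} {G : Mat E p q} (hG : G.det ≠ 0)
    (Y : Mat E p q) (i j) :
    G.det * (G * Y * G⁻¹) i j = (G * Y * G.adjugate) i j := by
  rw [Matrix.inv_def, Ring.inverse_eq_inv', Matrix.mul_smul, Matrix.smul_apply, smul_eq_mul,
    mul_inv_cancel_left₀ hG]

section Generic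

variable {K : Type*} [Field K] {p q : ℕ} {E : Type*} [Field E]
  [Algebra (MvPolynomial (Coord p q) K) E] [IsFractionRing (MvPolynomial (Coord p q) K) E]
  [Algebra K E] [IsScalarTower K (MvPolynomial (Coord p q) K) E]

/-- The conjugate of `Y` by the generic block diagonal matrix. -/
noncomputable def genConj (E : Type*) [Field E] [Algebra (MvPolynomial (Coord p q) K) E]
    [Algebra K E] (Y : Mat K p q) : Mat E p q :=
  blk (gen K p q E) * Y.map (algebraMap K E) * (blk (gen K p q E))⁻¹

/-- The comorphism of the orbit map. -/
noncomputable def orbitHom (E : Type*) [Field E] [Algebra (MvPolynomial (Coord p q) K) E]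
    [Algebra K E] (Y : Mat K p q) :
    MvPolynomial ((Fin p ⊕ Fin q) × (Fin p ⊕ Fin q)) K →ₐ[K] E :=
  MvPolynomial.aeval fun ij => genConj E Y ij.1 ij.2

/-- A power of the determinant clears the denominators of `f (g Y g⁻¹)`. One polynomial `r` serves
both the generic `g` and every invertible specialization, which links vanishing on the orbit to
vanishing in `E`. -/
theorem exists_numerator (Y : Mat K p q)
    (f : MvPolynomial ((Fin p ⊕ Fin q) × (Fin p ⊕ Fin q)) K) :
    ∃ (N : ℕ) (r : MvPolynomial (Coord p q) K),
      algebraMap _ E r = (blk (gen K p q E)).det ^ N * orbitHom E Y f ∧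
      ∀ x : Coord p q → K, (blk x).det ≠ 0 → MvPolynomial.eval x r =
        (blk x).det ^ N * MvPolynomial.eval (fun ij => (blk x * Y * (blk x)⁻¹) ij.1 ij.2) f := by
  induction f using MvPolynomial.induction_on with
  | C a =>
    refine ⟨0, MvPolynomial.C a, ?_, fun x _ => by simp⟩
    simp only [pow_zero, one_mul, orbitHom, MvPolynomial.aeval_C]
    exact (IsScalarTower.algebraMap_apply K (MvPolynomial (Coord p q) K) E a).symm
  | add f g hf hg =>
    obtain ⟨N, r, h1, h2⟩ := hf
    obtain ⟨M, s, h3, h4⟩ := hg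
    refine ⟨N + M, genDet K p q ^ M * r + genDet K p q ^ N * s, ?_, fun x hx => ?_⟩
    · simp only [map_add, map_mul, map_pow, algebraMap_genDet, h1, h3]
      ring
    · simp only [map_add, map_mul, map_pow, eval_genDet, h2 x hx, h4 x hx]
      ring
  | mul_X f ij hf =>
    obtain ⟨N, r, h1, h2⟩ := hf
    -- With the adjugate in place of the inverse, `W` is `det g` times the conjugate and has
    -- polynomial entries.
    let W := blk (MvPolynomial.X : Coord p q → MvPolynomial (Coord p q) K) *
      Y.map (algebraMap K _) * (blk MvPolynomial.X).adjugate
    refine ⟨N + 1, r * W ij.1 ij.2, ?_, fun x hx => ?_⟩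
    · have hW : algebraMap _ E (W ij.1 ij.2) =
          (blk (gen K p q E)).det * genConj E Y ij.1 ij.2 := by
        rw [genConj, det_mul_conj_apply det_gen_ne_zero]
        change (W.map (algebraMap _ E)) ij.1 ij.2 = _
        simp only [W, Matrix.map_mul]
        rw [← RingHom.mapMatrix_apply _ (adjugate _), RingHom.map_adjugate, RingHom.mapMatrix_apply,
          map_blk, Matrix.map_map, ← RingHom.coe_comp,
          ← IsScalarTower.algebraMap_eq K (MvPolynomial (Coord p q) K) E]
        rfl
      rw [map_mul, h1, hW, map_mul]
      simp only [orbitHom, MvPolynomial.aeval_X]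
      ring
    · have hW : MvPolynomial.eval x (W ij.1 ij.2) =
          (blk x).det * (blk x * Y * (blk x)⁻¹) ij.1 ij.2 := by
        rw [det_mul_conj_apply hx]
        change (W.map (MvPolynomial.eval x)) ij.1 ij.2 = _
        simp only [W, Matrix.map_mul]
        rw [← RingHom.mapMatrix_apply _ (adjugate _), RingHom.map_adjugate, RingHom.mapMatrix_apply,
          map_blk, Matrix.map_map]
        have h5 : (MvPolynomial.eval x ∘ MvPolynomial.X) = x := by ext; simp
        have h6 : (MvPolynomial.eval x ∘ algebraMap K (MvPolynomial (Coord p q) K)) = id := by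
          ext; simp
        rw [h5, h6, Matrix.map_id]
      rw [map_mul, h2 x hx, hW, map_mul, MvPolynomial.eval_X]
      ring

theorem mem_orbit_iff [CharZero K] {Y : Mat K p q} {v} :
    v ∈ orbit Y ↔ ∃ x : Coord p q → K, (blk x).det ≠ 0 ∧
      v = fun ij => (blk x * Y * (blk x)⁻¹) ij.1 ij.2 := by
  constructor
  · rintro ⟨g, hg, rfl⟩
    obtain ⟨x, hx⟩ := mem_groupOne_iff.mp hg
    refine ⟨x, hx ▸ (Matrix.GeneralLinearGroup.det g).ne_zero, ?_⟩
    rw [← hx, Matrix.coe_units_inv]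
  · rintro ⟨x, hx, rfl⟩
    refine ⟨Matrix.GeneralLinearGroup.mkOfDetNeZero (blk x) hx,
      mem_groupOne_iff.mpr ⟨x, rfl⟩, ?_⟩
    rw [Matrix.coe_units_inv]
    rfl

theorem vanishingIdeal_orbit [CharZero K] (Y : Mat K p q) :
    MvPolynomial.vanishingIdeal K (orbit Y) = RingHom.ker (orbitHom E Y) := by
  ext f
  obtain ⟨N, r, h1, h2⟩ := exists_numerator (E := E) Y f
  have h3 : f ∈ RingHom.ker (orbitHom E Y) ↔ r = 0 := by
    rw [RingHom.mem_ker, ← map_eq_zero_iff _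
      (IsFractionRing.injective (MvPolynomial (Coord p q) K) E), h1,
      mul_eq_zero_iff_left (pow_ne_zero _ det_gen_ne_zero)]
  rw [h3, MvPolynomial.mem_vanishingIdeal_iff]
  constructor
  · intro h
    -- The factor `genDet` takes care of the points where the matrix is singular; it is cancelled
    -- afterwards.
    have h4 : r * genDet K p q = 0 := by
      apply MvPolynomial.funext
      intro x
      rw [map_mul, eval_genDet, map_zero]
      by_cases hx : (blk x).det = 0
      · rw [hx, mul_zero]
      · have := h _ (mem_orbit_iff.mpr ⟨x, hx, rfl⟩)
        rw [MvPolynomial.aeval_eq_eval] at this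
        rw [h2 x hx, this, mul_zero, zero_mul]
    exact (mul_eq_zero_iff_right genDet_ne_zero).mp h4
  · rintro rfl v hv
    obtain ⟨x, hx, rfl⟩ := mem_orbit_iff.mp hv
    have := h2 x hx
    rw [map_zero, eq_comm, mul_eq_zero_iff_left (pow_ne_zero _ hx)] at this
    rwa [MvPolynomial.aeval_eq_eval]

end Generic

/-! ### The function field of `G(1)` over the coordinate ring of an orbit closure. -/

section Generic

variable {K : Type*} [Field K] {p q : ℕ} {E : Type*} [Field E]

/-- The linear system `w Y = Z w` on block diagonal matrices `w`, together with the coordinates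
`c` of `w`. -/
def systemMap {d : ℕ} (c : Fin d → Coord p q) (Y Z : Mat E p q) :
    (Coord p q → E) →ₗ[E] (((Fin p ⊕ Fin q) × (Fin p ⊕ Fin q)) ⊕ Fin d → E) where
  toFun y := Sum.elim (fun ij => (blk y * Y - Z * blk y) ij.1 ij.2) (fun i => y (c i))
  map_add' x y := by
    ext (i | i)
    · simp [Matrix.add_mul, Matrix.mul_add]; ring
    · simp
  map_smul' a x := by
    ext (i | i)
    · simp [mul_sub]
    · simp

theorem systemMap_eq_zero_iff {d : ℕ} {c : Fin d → Coord p q} {Y Z : Mat E p q}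
    {y : Coord p q → E} :
    systemMap c Y Z y = 0 ↔ blk y * Y = Z * blk y ∧ ∀ i, y (c i) = 0 := by
  constructor
  · intro h
    refine ⟨?_, fun i => congrFun h (.inr i)⟩
    rw [← sub_eq_zero]
    ext i j
    exact congrFun h (.inl (i, j))
  · rintro ⟨h1, h2⟩
    ext (i | i)
    · change (blk y * Y - Z * blk y) i.1 i.2 = 0
      rw [h1, sub_self]
      rfl
    · exact h2 i

theorem systemMap_single_mem [Algebra K E] {d : ℕ} (c : Fin d → Coord p q) {Y Z : Mat E p q}
    (k : IntermediateField K E) (hY : ∀ i j, Y i j ∈ k) (hZ : ∀ i j, Z i j ∈ k)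
    (s : Coord p q) (r) : systemMap c Y Z (Pi.single s 1) r ∈ k := by
  have h1 : ∀ t, (Pi.single s 1 : Coord p q → E) t ∈ k := by
    intro t
    rw [Pi.single_apply]
    split_ifs
    · exact one_mem k
    · exact zero_mem k
  have h2 : ∀ i j, blk (Pi.single s 1 : Coord p q → E) i j ∈ k := by
    rintro (i | i) (j | j)
    · exact h1 _
    · exact zero_mem k
    · exact zero_mem k
    · exact h1 _
  rcases r with r | r
  · have h3 : (blk (Pi.single s 1 : Coord p q → E) * Y) r.1 r.2 ∈ k := by
      rw [Matrix.mul_apply]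
      exact sum_mem fun _ _ => mul_mem (h2 _ _) (hY _ _)
    have h4 : (Z * blk (Pi.single s 1 : Coord p q → E)) r.1 r.2 ∈ k := by
      rw [Matrix.mul_apply]
      exact sum_mem fun _ _ => mul_mem (hZ _ _) (h2 _ _)
    exact sub_mem h3 h4
  · exact h1 _

/-- Block diagonal matrices over an extension that commute with a rational matrix `Y` are
determined by their coordinates in `c`, if rational ones are. -/
theorem eq_zero_of_commute_of_coordinates [Algebra K E] {Y : Mat K p q} {d : ℕ}
    {c : Fin d → Coord p q} (hc : ∀ y ∈ stabilizer Y, (∀ i, y (c i) = 0) → y = 0)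
    {y : Coord p q → E}
    (hy : blk y * Y.map (algebraMap K E) = Y.map (algebraMap K E) * blk y)
    (h0 : ∀ i, y (c i) = 0) : y = 0 := by
  classical
  have hYk : ∀ i j, Y.map (algebraMap K E) i j ∈ (⊥ : IntermediateField K E) :=
    fun i j => algebraMap_mem _ _
  obtain ⟨g, hg, -⟩ := exists_rational_leftInverse (⊥ : IntermediateField K E)
    (systemMap c (Y.map (algebraMap K E)) (Y.map (algebraMap K E)))
    (systemMap_single_mem c _ hYk hYk) (by
      intro z hz hfz
      rw [systemMap_eq_zero_iff] at hfz
      choose w hw using fun s => IntermediateField.mem_bot.mp (hz s)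
      obtain rfl : algebraMap K E ∘ w = z := funext hw
      rw [← map_blk, ← Matrix.map_mul, ← Matrix.map_mul] at hfz
      have hw0 := hc w (mem_stabilizer.mpr
        (Matrix.map_injective (algebraMap K E).injective hfz.1))
        fun i => (algebraMap K E).injective (by simpa using hfz.2 i)
      rw [hw0]
      ext
      simp)
  rw [← LinearMap.id_apply (R := E) y, ← hg, LinearMap.comp_apply,
    systemMap_eq_zero_iff.mpr ⟨hy, h0⟩, map_zero]

variable [Algebra (MvPolynomial (Coord p q) K) E] [Algebra K E]

/-- The coordinates `c i` of the products of the generic block diagonal matrix with the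
matrices `h j`. -/
noncomputable def transition (E : Type*) [Field E] [Algebra (MvPolynomial (Coord p q) K) E]
    [Algebra K E] {d : ℕ} (c : Fin d → Coord p q) (h : Fin d → Coord p q → K) :
    Matrix (Fin d) (Fin d) E :=
  of fun i j => coords (blk (gen K p q E) * blk (algebraMap K E ∘ h j)) (c i)

theorem coords_gen_mul_sum {d : ℕ} (c : Fin d → Coord p q)
    (h : Fin d → Coord p q → K) (a : Fin d → E) (i : Fin d) :
    coords (blk (gen K p q E) * blk (∑ j, a j • (algebraMap K E ∘ h j))) (c i) =
      (transition E c h *ᵥ a) i := by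
  simp only [map_sum, map_smul, Matrix.mul_sum, Matrix.mul_smul, Finset.sum_apply, Pi.smul_apply,
    smul_eq_mul, Matrix.mulVec, dotProduct, transition, of_apply]
  exact Finset.sum_congr rfl fun j _ => mul_comm _ _

variable [IsFractionRing (MvPolynomial (Coord p q) K) E]
  [IsScalarTower K (MvPolynomial (Coord p q) K) E]

/-- At `g = 1` the matrix specializes to the identity, because `h` is dual to the coordinates `c`.
-/
theorem det_transition_ne_zero {d : ℕ} {c : Fin d → Coord p q}
    {h : Fin d → Coord p q → K} (hh : ∀ i j, h i (c j) = if j = i then 1 else 0) :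
    (transition E c h).det ≠ 0 := by
  let T : Matrix (Fin d) (Fin d) (MvPolynomial (Coord p q) K) :=
    of fun i j => coords (blk MvPolynomial.X * blk (algebraMap K _ ∘ h j)) (c i)
  have h1 : transition E c h = T.map (algebraMap _ E) := by
    ext i j
    have : algebraMap _ E (T i j) =
        ((algebraMap _ E) ∘ coords (blk MvPolynomial.X * blk (algebraMap K _ ∘ h j))) (c i) := rfl
    rw [Matrix.map_apply, this, ← coords_map, Matrix.map_mul, map_blk, map_blk,
      ← Function.comp_assoc, ← RingHom.coe_comp,
      ← IsScalarTower.algebraMap_eq K (MvPolynomial (Coord p q) K) E]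
    rfl
  have h2 : T.map (MvPolynomial.eval (coords (1 : Mat K p q))) = 1 := by
    ext i j
    have : MvPolynomial.eval (coords (1 : Mat K p q)) (T i j) =
        ((MvPolynomial.eval (coords (1 : Mat K p q))) ∘
          coords (blk MvPolynomial.X * blk (algebraMap K _ ∘ h j))) (c i) := rfl
    have h5 : (MvPolynomial.eval (coords (1 : Mat K p q)) ∘ MvPolynomial.X) =
      coords (1 : Mat K p q) := by ext; simp
    have h6 : (MvPolynomial.eval (coords (1 : Mat K p q)) ∘
        algebraMap K (MvPolynomial (Coord p q) K)) = id := by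
      ext; simp
    rw [Matrix.map_apply, this, ← coords_map, Matrix.map_mul, map_blk, map_blk,
      ← Function.comp_assoc, h5, h6, blk_coords_one, Matrix.one_mul, Function.id_comp, coords_blk,
      hh, Matrix.one_apply]
  rw [h1, ← RingHom.mapMatrix_apply, ← RingHom.map_det]
  refine (map_ne_zero_iff _ (IsFractionRing.injective _ _)).mpr fun h0 => ?_
  have h3 := congrArg (MvPolynomial.eval (coords (1 : Mat K p q))) h0
  rw [RingHom.map_det, RingHom.mapMatrix_apply, h2] at h3
  simp at h3

/-- If `w Y = (g Y g⁻¹) w`, then `z = g⁻¹ w` commutes with `Y`, hence is an `E`-combination of the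
`h j`. The coordinates `c` of `w = g z` are the transition matrix applied to its coefficients, so
their vanishing forces `z = 0`. -/
theorem systemMap_genConj_injective {Y : Mat K p q} {d : ℕ} {c : Fin d → Coord p q}
    (hc : ∀ y ∈ stabilizer Y, (∀ i, y (c i) = 0) → y = 0) {h : Fin d → Coord p q → K}
    (hmem : ∀ i, h i ∈ stabilizer Y) (hh : ∀ i j, h i (c j) = if j = i then 1 else 0)
    (y : Coord p q → E)
    (hy : systemMap c (Y.map (algebraMap K E)) (genConj E Y) y = 0) : y = 0 := by
  rw [systemMap_eq_zero_iff] at hy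
  obtain ⟨hy1, hy2⟩ := hy
  obtain ⟨x, hx1, hx2⟩ := exists_blk_inverse (det_gen_ne_zero (K := K) (p := p) (q := q) (E := E))
  have hinv : (blk (gen K p q E))⁻¹ = blk x := Matrix.inv_eq_right_inv hx1
  rw [genConj, hinv] at hy1
  set z := coords (blk x * blk y) with hz
  have hz1 : blk z = blk x * blk y := blk_coords_mul x y
  have hz2 : blk z * Y.map (algebraMap K E) = Y.map (algebraMap K E) * blk z := by
    rw [hz1, Matrix.mul_assoc, hy1]
    simp only [← Matrix.mul_assoc]
    rw [hx2, Matrix.one_mul]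
  have hz3 : z = ∑ j, z (c j) • (algebraMap K E ∘ h j) := by
    rw [← sub_eq_zero]
    apply eq_zero_of_commute_of_coordinates hc
    · rw [map_sub, map_sum, Matrix.sub_mul, Matrix.mul_sub, hz2, Matrix.sum_mul, Matrix.mul_sum]
      congr 1
      refine Finset.sum_congr rfl fun j _ => ?_
      rw [map_smul, Matrix.smul_mul, Matrix.mul_smul, ← map_blk, ← Matrix.map_mul,
        mem_stabilizer.mp (hmem j), Matrix.map_mul]
    · intro i
      simp [hh]
  have hz4 : transition E c h *ᵥ (fun j => z (c j)) = 0 := by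
    ext i
    rw [← coords_gen_mul_sum, ← hz3, hz1, ← Matrix.mul_assoc, hx1, Matrix.one_mul, coords_blk]
    exact hy2 i
  have hz5 := Matrix.eq_zero_of_mulVec_eq_zero (det_transition_ne_zero hh) hz4
  have hz6 : z = 0 := by
    rw [hz3]
    refine Finset.sum_eq_zero fun j _ => ?_
    rw [congrFun hz5 j]
    simp
  apply blk_injective
  rw [map_zero, ← Matrix.one_mul (blk y), ← hx1, Matrix.mul_assoc, ← hz1, hz6]
  simp

end Generic

section Generic

variable {K : Type*} [Field K] {p q : ℕ} {E : Type*} [Field E]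
  [Algebra (MvPolynomial (Coord p q) K) E] [Algebra K E]

theorem genConj_mem_range (Y : Mat K p q) (i j) : genConj E Y i j ∈ (orbitHom E Y).range :=
  ⟨MvPolynomial.X (i, j), MvPolynomial.aeval_X _ _⟩

variable [IsFractionRing (MvPolynomial (Coord p q) K) E]

theorem genConj_mul_blk_gen (Y : Mat K p q) :
    genConj E Y * blk (gen K p q E) = blk (gen K p q E) * Y.map (algebraMap K E) := by
  rw [genConj, Matrix.mul_assoc _ _ (blk _), Matrix.nonsing_inv_mul _
    (isUnit_iff_ne_zero.mpr det_gen_ne_zero), Matrix.mul_one]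

theorem algHom_coords_mul {A B : Type*} [CommRing A] [CommRing B] [Algebra K A] [Algebra K B]
    (φ : A →ₐ[K] B) (x : Coord p q → A) (w : Coord p q → K) (s : Coord p q) :
    φ (coords (blk x * blk (algebraMap K A ∘ w)) s) =
      coords (blk (φ ∘ x) * blk (algebraMap K B ∘ w)) s := by
  have h := congrFun (coords_map (φ : A →+* B) (blk x * blk (algebraMap K A ∘ w))) s
  rw [Matrix.map_mul, map_blk, map_blk] at h
  have h2 : (φ : A →+* B) ∘ algebraMap K A ∘ w = algebraMap K B ∘ w := by
    ext t
    simp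
  rw [h2] at h
  exact h.symm

variable [IsScalarTower K (MvPolynomial (Coord p q) K) E]

/-- The generic `g` is the only block diagonal `w` with `w Y = (g Y g⁻¹) w` and the same coordinates
`c`. This linear system has coefficients in the field generated by the entries of `g Y g⁻¹` and the
`c`-entries of `g`, so that field is all of `E`. -/
theorem isAlgebraic_adjoin_coordinates {Y : Mat K p q} {d : ℕ} {c : Fin d → Coord p q}
    (hc : ∀ y ∈ stabilizer Y, (∀ i, y (c i) = 0) → y = 0) {h : Fin d → Coord p q → K}
    (hmem : ∀ i, h i ∈ stabilizer Y) (hh : ∀ i j, h i (c j) = if j = i then 1 else 0) :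
    Algebra.IsAlgebraic
      (Algebra.adjoin (orbitHom E Y).range (Set.range fun i => gen K p q E (c i))) E := by
  classical
  set B := Algebra.adjoin (orbitHom E Y).range (Set.range fun i => gen K p q E (c i)) with hB
  let S : Set E := (Set.range fun ij : (Fin p ⊕ Fin q) × (Fin p ⊕ Fin q) =>
    genConj E Y ij.1 ij.2) ∪ Set.range fun i => gen K p q E (c i)
  have hS : ∀ x ∈ Algebra.adjoin K S, x ∈ B := by
    intro x hx
    induction hx using Algebra.adjoin_induction with
    | mem x hx =>
      rcases hx with ⟨ij, rfl⟩ | hx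
      · exact B.algebraMap_mem ⟨_, genConj_mem_range Y ij.1 ij.2⟩
      · rw [hB]
        exact Algebra.subset_adjoin hx
    | algebraMap a => exact B.algebraMap_mem (algebraMap K (orbitHom E Y).range a)
    | add x y _ _ hx hy => exact add_mem hx hy
    | mul x y _ _ hx hy => exact mul_mem hx hy
  have halg : ∀ x ∈ IntermediateField.adjoin K S, IsAlgebraic B x := by
    intro x hx
    obtain ⟨r, hr, s, hs, rfl⟩ := IntermediateField.mem_adjoin_iff_div.mp hx
    rw [div_eq_mul_inv]
    exact (isAlgebraic_algebraMap (⟨r, hS r hr⟩ : B)).mul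
      (isAlgebraic_algebraMap (⟨s, hS s hs⟩ : B)).inv
  have hZ : ∀ i j, genConj E Y i j ∈ IntermediateField.adjoin K S := fun i j =>
    IntermediateField.subset_adjoin _ _ (.inl ⟨(i, j), rfl⟩)
  have hgen : ∀ s, gen K p q E s ∈ IntermediateField.adjoin K S := by
    refine mem_of_rational_system _ (systemMap c (Y.map (algebraMap K E)) (genConj E Y))
      (systemMap_single_mem c _ (fun i j => algebraMap_mem _ _) hZ)
      (systemMap_genConj_injective hc hmem hh) _ ?_
    rintro (r | r)
    · change (blk (gen K p q E) * Y.map (algebraMap K E) -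
        genConj E Y * blk (gen K p q E)) r.1 r.2 ∈ _
      rw [genConj_mul_blk_gen, sub_self]
      exact zero_mem _
    · exact IntermediateField.subset_adjoin _ _ (.inr ⟨r, rfl⟩)
  have hR : ∀ r : MvPolynomial (Coord p q) K,
      algebraMap _ E r ∈ IntermediateField.adjoin K S := by
    intro r
    induction r using MvPolynomial.induction_on with
    | C a =>
      have := IsScalarTower.algebraMap_apply K (MvPolynomial (Coord p q) K) E a
      rw [MvPolynomial.algebraMap_eq] at this
      rw [← this]
      exact algebraMap_mem _ _
    | add f g hf hg => rw [map_add]; exact add_mem hf hg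
    | mul_X f s hf => rw [map_mul]; exact mul_mem hf (hgen s)
  refine ⟨fun x => halg x ?_⟩
  obtain ⟨a, b, -, rfl⟩ := IsFractionRing.div_surjective (A := MvPolynomial (Coord p q) K) x
  exact div_mem (hR a) (hR b)

/-- Right translation `g ↦ g u` fixes `g Y g⁻¹` when `u` commutes with `Y`. -/
theorem exists_translation {Y : Mat K p q} {u : Coord p q → K} (hu : u ∈ stabilizer Y)
    (hdet : (blk u).det ≠ 0) :
    ∃ τ : E →ₐ[(orbitHom E Y).range] E,
      ∀ s, τ (gen K p q E s) = coords (blk (gen K p q E) * blk (algebraMap K E ∘ u)) s := by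
  obtain ⟨u', hu1, hu2⟩ := exists_blk_inverse hdet
  let R := MvPolynomial (Coord p q) K
  let tr (w : Coord p q → K) : R →ₐ[K] R :=
    MvPolynomial.aeval (coords (blk MvPolynomial.X * blk (algebraMap K R ∘ w)))
  have htrX (w : Coord p q → K) :
      tr w ∘ MvPolynomial.X = coords (blk MvPolynomial.X * blk (algebraMap K R ∘ w)) := by
    ext1 s
    exact MvPolynomial.aeval_X _ _
  -- Translation by the inverse of `u` undoes translation by `u`; the resulting injectivity lets it
  -- extend to the fraction field.
  have htr : (tr u').comp (tr u) = AlgHom.id K R := by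
    apply MvPolynomial.algHom_ext
    intro s
    have h1 : tr u (MvPolynomial.X s) = _ := congrFun (htrX u) s
    rw [AlgHom.comp_apply, h1, algHom_coords_mul, htrX, blk_coords_mul, Matrix.mul_assoc,
      ← map_blk, ← map_blk, ← Matrix.map_mul, hu2, Matrix.map_one _ (map_zero _) (map_one _),
      Matrix.mul_one, coords_blk]
    rfl
  have hinj : Function.Injective ((IsScalarTower.toAlgHom K R E).comp (tr u)) := by
    refine (IsFractionRing.injective R E).comp (Function.LeftInverse.injective (g := tr u') ?_)
    intro r
    exact AlgHom.congr_fun htr r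
  let τ : E →ₐ[K] E := IsFractionRing.liftAlgHom hinj
  have hτ : τ ∘ gen K p q E = coords (blk (gen K p q E) * blk (algebraMap K E ∘ u)) := by
    ext1 s
    have h1 : tr u (MvPolynomial.X s) = _ := congrFun (htrX u) s
    have h2 : τ (gen K p q E s) = IsScalarTower.toAlgHom K R E (tr u (MvPolynomial.X s)) :=
      IsFractionRing.lift_algebraMap hinj _
    rw [Function.comp_apply, h2, h1, algHom_coords_mul]
    rfl
  have hZ : (genConj E Y).map τ = genConj E Y := by
    have h1 := congrArg (fun M => M.map (τ : E →+* E)) (genConj_mul_blk_gen (E := E) Y)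
    simp only [Matrix.map_mul, map_blk, Matrix.map_map] at h1
    have h2 : (τ : E →+* E) ∘ algebraMap K E = algebraMap K E := by
      ext t
      simp
    have h3 : (τ : E →+* E) ∘ gen K p q E = _ := hτ
    have h4 : blk (algebraMap K E ∘ u) * Y.map (algebraMap K E) =
        Y.map (algebraMap K E) * blk (algebraMap K E ∘ u) := by
      rw [← map_blk, ← Matrix.map_mul, ← Matrix.map_mul, mem_stabilizer.mp hu]
    rw [h2, h3, blk_coords_mul, Matrix.mul_assoc, h4, ← Matrix.mul_assoc, ← Matrix.mul_assoc,
      ← genConj_mul_blk_gen] at h1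
    have h5 : blk (algebraMap K E ∘ u) * blk (algebraMap K E ∘ u') = 1 := by
      rw [← map_blk, ← map_blk, ← Matrix.map_mul, hu1, Matrix.map_one _ (map_zero _) (map_one _)]
    have h6 := congrArg (fun M => M * blk (algebraMap K E ∘ u') * (blk (gen K p q E))⁻¹) h1
    simp only [Matrix.mul_assoc _ (blk (algebraMap K E ∘ u)), h5, Matrix.mul_one,
      Matrix.mul_nonsing_inv_cancel_right _ _
        (isUnit_iff_ne_zero.mpr (det_gen_ne_zero (K := K) (p := p) (q := q) (E := E)))] at h6
    exact h6
  have hfix : τ.comp (orbitHom E Y) = orbitHom E Y := by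
    apply MvPolynomial.algHom_ext
    intro ij
    have h1 : orbitHom E Y (MvPolynomial.X ij) = genConj E Y ij.1 ij.2 := MvPolynomial.aeval_X _ _
    rw [AlgHom.comp_apply, h1]
    exact congrFun₂ hZ ij.1 ij.2
  refine ⟨{ (τ : E →+* E) with commutes' := ?_ }, fun s => congrFun hτ s⟩
  rintro ⟨_, f, rfl⟩
  exact AlgHom.congr_fun hfix f

/-- Translating a relation `P` by the stabilizer element `u t = ∑ t j • h j` keeps its coefficients
and moves the `c`-entries of `g` to `M t`, with `M` invertible. So `P` vanishes at `M t` for all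
rational `t` with `u t` invertible, and these are Zariski dense. -/
theorem algebraicIndependent_coordinates [CharZero K] {Y : Mat K p q} {d : ℕ}
    {c : Fin d → Coord p q}
    (hc : ∀ y ∈ stabilizer Y, (∀ i, y (c i) = 0) → y = 0) {h : Fin d → Coord p q → K}
    (hmem : ∀ i, h i ∈ stabilizer Y) (hh : ∀ i j, h i (c j) = if j = i then 1 else 0) :
    AlgebraicIndependent (orbitHom E Y).range fun i => gen K p q E (c i) := by
  rw [algebraicIndependent_iff]
  intro P hP
  have : CharZero E := charZero_of_injective_algebraMap (algebraMap K E).injective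
  let M := transition E c h
  have hM : IsUnit M.det := isUnit_iff_ne_zero.mpr (det_transition_ne_zero hh)
  let PE : MvPolynomial (Fin d) E := MvPolynomial.map (algebraMap (orbitHom E Y).range E) P
  let Q : MvPolynomial (Fin d) E :=
    MvPolynomial.bind₁ (fun i => ∑ j, MvPolynomial.C (M i j) * MvPolynomial.X j) PE
  have hQ (a : Fin d → E) : MvPolynomial.eval a Q = MvPolynomial.eval (M *ᵥ a) PE := by
    have h1 : ∀ φ : MvPolynomial (Fin d) E, MvPolynomial.eval a φ = MvPolynomial.aeval a φ :=
      fun φ => by rw [MvPolynomial.aeval_eq_eval]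
    rw [h1, MvPolynomial.aeval_bind₁, MvPolynomial.aeval_eq_eval]
    congr 2
    ext i
    simp [Matrix.mulVec, dotProduct]
  let u (t : Fin d → K) : Coord p q → K := ∑ j, t j • h j
  have hu (t : Fin d → K) : u t ∈ stabilizer Y :=
    sum_mem fun j _ => Submodule.smul_mem _ _ (hmem j)
  -- The determinant of `u t` as a polynomial in `t`; it is nonzero because the identity commutes
  -- with `Y` and so is some `u t`.
  let D : MvPolynomial (Fin d) E :=
    (blk (∑ j, (MvPolynomial.X j : MvPolynomial (Fin d) E) •
      fun s => MvPolynomial.C (algebraMap K E (h j s)))).det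
  have hut (t : Fin d → K) :
      algebraMap K E ∘ u t = ∑ j, algebraMap K E (t j) • (algebraMap K E ∘ h j) := by
    ext s
    simp [u, Algebra.smul_def]
  have hD (t : Fin d → K) :
      MvPolynomial.eval (algebraMap K E ∘ t) D = algebraMap K E (blk (u t)).det := by
    rw [RingHom.map_det, RingHom.map_det, RingHom.mapMatrix_apply, RingHom.mapMatrix_apply,
      map_blk, map_blk, hut]
    congr 2
    ext s
    simp [Algebra.smul_def]
  have hQD : Q * D = 0 := by
    refine MvPolynomial.funext_set (fun _ => Set.range (algebraMap K E))
      (fun _ => Set.infinite_range_of_injective (algebraMap K E).injective) ?_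
    intro a ha
    choose t ht using fun i => ha i trivial
    obtain rfl : algebraMap K E ∘ t = a := funext ht
    rw [map_mul, map_zero, hD, hQ]
    by_cases hdet : (blk (u t)).det = 0
    · rw [hdet, map_zero, mul_zero]
    · obtain ⟨τ, hτ⟩ := exists_translation (E := E) (hu t) hdet
      have h1 := congrArg τ hP
      rw [map_zero, ← AlgHom.comp_apply, MvPolynomial.comp_aeval] at h1
      have h2 : (fun i => τ (gen K p q E (c i))) = M *ᵥ (algebraMap K E ∘ t) := by
        ext i
        rw [hτ, hut]
        exact coords_gen_mul_sum c h _ i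
      rw [h2] at h1
      rw [MvPolynomial.eval_map, ← MvPolynomial.aeval_def, h1, zero_mul]
  have hD0 : D ≠ 0 := by
    intro h0
    have h1 : u (fun j => coords (1 : Mat K p q) (c j)) = coords 1 := by
      rw [← sub_eq_zero]
      refine hc _ (sub_mem (hu _) ?_) fun i => ?_
      · rw [mem_stabilizer, blk_coords_one, Matrix.one_mul, Matrix.mul_one]
      · simp [u, hh]
    have h2 := hD fun j => coords (1 : Mat K p q) (c j)
    rw [h0, h1, blk_coords_one] at h2
    simp at h2
  have hQ0 : Q = 0 := (mul_eq_zero_iff_right hD0).mp hQD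
  have hPE : PE = 0 := by
    apply MvPolynomial.funext
    intro b
    have h1 := hQ (M⁻¹ *ᵥ b)
    rw [hQ0, Matrix.mulVec_mulVec, Matrix.mul_nonsing_inv _ hM, Matrix.one_mulVec] at h1
    exact h1.symm
  exact (map_eq_zero_iff _ (MvPolynomial.map_injective _ Subtype.val_injective)).mp hPE

end Generic

/-- Additivity of transcendence degree in `K ⊆ A ⊆ E`, with `A` the coordinate ring of the orbit
closure and `E` the function field of `G(1)`. -/
theorem orbitDim_eq {K : Type*} [Field K] [CharZero K] {p q : ℕ} (Y : Mat K p q) :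
    ∃ n : ℕ, orbitDim Y = n ∧ n + Module.finrank K (stabilizer Y) = p * p + q * q := by
  let R := MvPolynomial (Coord p q) K
  let E := FractionRing R
  obtain ⟨c, hc, h, hmem, hh⟩ := exists_coordinates (stabilizer Y)
  have hind := algebraicIndependent_coordinates (E := E) hc hmem hh
  have halg := isAlgebraic_adjoin_coordinates (E := E) hc hmem hh
  have : Algebra.IsAlgebraic R E := IsLocalization.isAlgebraic E (nonZeroDivisors R)
  let A := (orbitHom E Y).range
  have hbasis := hind.isTranscendenceBasis_iff_isAlgebraic.mpr halg
  have h1 := hbasis.lift_cardinalMk_eq_trdeg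
  have h2 := trdeg_add_eq K A (A := E)
  have h3 : Algebra.trdeg K E = (p * p + q * q : ℕ) := by
    have h4 := trdeg_add_eq K R (A := E)
    rw [trdeg_eq_zero (R := R) (A := E), MvPolynomial.trdeg_of_isDomain] at h4
    simpa using h4.symm
  let ε : (MvPolynomial ((Fin p ⊕ Fin q) × (Fin p ⊕ Fin q)) K ⧸
      MvPolynomial.vanishingIdeal K (orbit Y)) ≃ₐ[K] A :=
    (Ideal.quotientEquivAlgOfEq K (vanishingIdeal_orbit (E := E) Y)).trans
      (Ideal.quotientKerEquivRange (orbitHom E Y))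
  have h5 : orbitDim Y = ringKrullDim A := ringKrullDim_eq_of_ringEquiv ε.toRingEquiv
  have : Algebra.FiniteType K A := Algebra.FiniteType.of_surjective (orbitHom E Y).rangeRestrict
    (orbitHom E Y).rangeRestrict_surjective
  refine ⟨Cardinal.toNat (Algebra.trdeg K A), by rw [h5, ringKrullDim_eq_trdeg K A], ?_⟩
  rw [h3] at h2
  have h6 : Algebra.trdeg A E = (Module.finrank K (stabilizer Y) : ℕ) := by
    simpa using h1.symm
  rw [h6] at h2
  have h7 : Algebra.trdeg K A < Cardinal.aleph0 := trdeg_lt_aleph0_of_finiteType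
  obtain ⟨m, hm⟩ := Cardinal.lt_aleph0.mp h7
  rw [hm] at h2 ⊢
  rw [Cardinal.toNat_natCast]
  exact_mod_cast h2

/-! ### The space `g(-1)` and its trace form. -/

section Minus

variable {K : Type*} [Field K] {p q : ℕ}

theorem theta_fromBlocks (P : Matrix (Fin p) (Fin p) K) (C : Matrix (Fin p) (Fin q) K)
    (D : Matrix (Fin q) (Fin p) K) (Q : Matrix (Fin q) (Fin q) K) :
    theta K p q (fromBlocks P C D Q) = fromBlocks P (-C) (-D) Q := by
  change fromBlocks 1 0 0 (-1) * fromBlocks P C D Q * fromBlocks 1 0 0 (-1) = _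
  simp [fromBlocks_multiply]

theorem fromBlocks_mem_gMinus (C : Matrix (Fin p) (Fin q) K) (D : Matrix (Fin q) (Fin p) K) :
    fromBlocks 0 C D 0 ∈ gMinus K p q := by
  rw [gMinus, Module.End.mem_eigenspace_iff, theta_fromBlocks]
  simp [fromBlocks_neg]

theorem mem_gMinus_iff [CharZero K] {X : Mat K p q} : X ∈ gMinus K p q ↔
    ∃ (C : Matrix (Fin p) (Fin q) K) (D : Matrix (Fin q) (Fin p) K), X = fromBlocks 0 C D 0 := by
  constructor
  · intro h
    rw [gMinus, Module.End.mem_eigenspace_iff, ← fromBlocks_toBlocks X, theta_fromBlocks,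
      neg_one_smul, fromBlocks_neg, fromBlocks_inj] at h
    have h1 : X.toBlocks₁₁ = 0 := by ext i j; exact self_eq_neg.mp (congrFun₂ h.1 i j)
    have h2 : X.toBlocks₂₂ = 0 := by ext i j; exact self_eq_neg.mp (congrFun₂ h.2.2.2 i j)
    exact ⟨X.toBlocks₁₂, X.toBlocks₂₁, by rw [← h1, ← h2, fromBlocks_toBlocks]⟩
  · rintro ⟨C, D, rfl⟩
    exact fromBlocks_mem_gMinus C D

/-- The off-diagonal matrices, parametrized by their blocks. -/
def minusEquiv (K : Type*) [Field K] [CharZero K] (p q : ℕ) :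
    (Matrix (Fin p) (Fin q) K × Matrix (Fin q) (Fin p) K) ≃ₗ[K] gMinus K p q where
  toFun CD := ⟨fromBlocks 0 CD.1 CD.2 0, fromBlocks_mem_gMinus _ _⟩
  map_add' x y := by ext1; simp [fromBlocks_add]
  map_smul' c x := by ext1; simp [fromBlocks_smul]
  invFun X := (X.1.toBlocks₁₂, X.1.toBlocks₂₁)
  left_inv x := by simp
  right_inv := by
    rintro ⟨X, hX⟩
    obtain ⟨C, D, rfl⟩ := mem_gMinus_iff.mp hX
    simp

theorem finrank_gMinus (K : Type*) [Field K] [CharZero K] (p q : ℕ) :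
    Module.finrank K (gMinus K p q) = 2 * (p * q) := by
  rw [← (minusEquiv K p q).finrank_eq]
  simp [Module.finrank_matrix]
  ring

theorem mem_centralizerMinus {X Y : Mat K p q} :
    Y ∈ centralizerMinus X ↔ Y ∈ gMinus K p q ∧ X * Y = Y * X := by
  simp [centralizerMinus, sub_eq_zero]

theorem odd_pow_mem_gMinus {X : Mat K p q} (hX : X ∈ gMinus K p q) (i : ℕ) :
    X ^ (2 * i + 1) ∈ gMinus K p q := by
  rw [gMinus, Module.End.mem_eigenspace_iff] at hX ⊢
  have hθ : ∀ n : ℕ, theta K p q (X ^ n) = (theta K p q X) ^ n := by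
    intro n
    change (signature K p q : Mat K p q) * X ^ n * ((signature K p q)⁻¹ : GL _ K).val =
      ((signature K p q : Mat K p q) * X * ((signature K p q)⁻¹ : GL _ K).val) ^ n
    exact (Units.conj_pow (signature K p q) X n).symm
  rw [hθ, hX, neg_one_smul, neg_one_smul, Odd.neg_pow ⟨i, rfl⟩]

/-- The restriction to `g(-1)` of `ad X`. -/
def adMinus (X : Mat K p q) : gMinus K p q →ₗ[K] Mat K p q :=
  (LinearMap.mulLeft K X - LinearMap.mulRight K X) ∘ₗ (gMinus K p q).subtype

@[simp]
theorem adMinus_apply (X : Mat K p q) (Y : gMinus K p q) :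
    adMinus X Y = X * Y - Y * X := rfl

theorem finrank_range_adMinus_add [CharZero K] (X : Mat K p q) :
    Module.finrank K (LinearMap.range (adMinus X)) + Module.finrank K (centralizerMinus X) =
      2 * (p * q) := by
  rw [← finrank_gMinus K p q, ← LinearMap.finrank_range_add_finrank_ker (adMinus X)]
  congr 1
  rw [adMinus, LinearMap.ker_comp, centralizerMinus, ← Submodule.map_comap_subtype,
    Submodule.finrank_map_subtype_eq]

/-- The off-diagonal part of a matrix. -/
def minusPart (X : Mat K p q) : Mat K p q := fromBlocks 0 X.toBlocks₁₂ X.toBlocks₂₁ 0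

theorem minusPart_mem (X : Mat K p q) : minusPart X ∈ gMinus K p q := fromBlocks_mem_gMinus _ _

theorem trace_fromBlocks (P : Matrix (Fin p) (Fin p) K) (C : Matrix (Fin p) (Fin q) K)
    (D : Matrix (Fin q) (Fin p) K) (Q : Matrix (Fin q) (Fin q) K) :
    trace (fromBlocks P C D Q) = trace P + trace Q := by
  simp [trace]

theorem trace_mul_minusPart [CharZero K] {X : Mat K p q} (hX : X ∈ gMinus K p q) (W : Mat K p q) :
    trace (X * minusPart W) = trace (X * W) := by
  obtain ⟨C, D, rfl⟩ := mem_gMinus_iff.mp hX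
  conv_rhs => rw [← fromBlocks_toBlocks W]
  simp [minusPart, fromBlocks_multiply, trace_fromBlocks]

theorem commute_minusPart [CharZero K] {X : Mat K p q} (hX : X ∈ gMinus K p q) {W : Mat K p q}
    (hW : X * W = W * X) : X * minusPart W = minusPart W * X := by
  obtain ⟨C, D, rfl⟩ := mem_gMinus_iff.mp hX
  rw [← fromBlocks_toBlocks W, fromBlocks_multiply, fromBlocks_multiply, fromBlocks_inj] at hW
  simp only [Matrix.zero_mul, Matrix.mul_zero, add_zero, zero_add] at hW
  rw [minusPart, fromBlocks_multiply, fromBlocks_multiply]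
  simp [hW.1, hW.2.2.2]

theorem eq_zero_of_trace_mul_eq_zero {X : Mat K p q} (h : ∀ W, trace (X * W) = 0) : X = 0 := by
  rw [Matrix.ext_iff_trace_mul_right]
  intro W
  rw [h, Matrix.zero_mul, trace_zero]

/-- The trace form on `g(-1)`. -/
def traceMinus (K : Type*) [Field K] (p q : ℕ) : LinearMap.BilinForm K (gMinus K p q) :=
  LinearMap.mk₂ K (fun X Y => trace (X.1 * Y.1))
    (by simp [Matrix.add_mul]) (by simp) (by simp [Matrix.mul_add]) (by simp)

theorem traceMinus_isRefl : (traceMinus K p q).IsRefl := by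
  intro X Y h
  change trace (Y.1 * X.1) = 0
  rw [trace_mul_comm]
  exact h

theorem traceMinus_nondegenerate [CharZero K] : (traceMinus K p q).Nondegenerate := by
  refine (LinearMap.IsRefl.nondegenerate_iff_separatingLeft (B := traceMinus K p q)
    traceMinus_isRefl).mpr ?_
  intro X hX
  apply Subtype.ext
  apply eq_zero_of_trace_mul_eq_zero
  intro W
  rw [← trace_mul_minusPart X.2]
  exact hX ⟨minusPart W, minusPart_mem W⟩

theorem trace_mul_blk_coords {U : Mat K p q} {w : Coord p q → K} (hU : U = blk w) (W : Mat K p q) :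
    trace (U * blk (coords W)) = trace (U * W) := by
  subst hU
  conv_rhs => rw [← fromBlocks_toBlocks W]
  rw [blk_apply, blk_apply, fromBlocks_multiply, fromBlocks_multiply, trace_fromBlocks,
    trace_fromBlocks]
  simp only [Matrix.zero_mul, Matrix.mul_zero, add_zero, zero_add]
  rfl

theorem commutator_eq_blk [CharZero K] {X Z : Mat K p q} (hX : X ∈ gMinus K p q)
    (hZ : Z ∈ gMinus K p q) : ∃ w, X * Z - Z * X = blk w := by
  obtain ⟨C, D, rfl⟩ := mem_gMinus_iff.mp hX
  obtain ⟨C', D', rfl⟩ := mem_gMinus_iff.mp hZ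
  refine ⟨coords (fromBlocks (C * D' - C' * D) 0 0 (D * C' - D' * C)), ?_⟩
  rw [blk_coords_fromBlocks, fromBlocks_multiply, fromBlocks_multiply, sub_eq_add_neg,
    fromBlocks_neg, fromBlocks_add]
  simp [sub_eq_add_neg]

theorem blk_commutator_mem [CharZero K] {X : Mat K p q} (hX : X ∈ gMinus K p q)
    (y : Coord p q → K) : blk y * X - X * blk y ∈ gMinus K p q := by
  obtain ⟨C, D, rfl⟩ := mem_gMinus_iff.mp hX
  rw [blk_apply, fromBlocks_multiply, fromBlocks_multiply]
  simp only [Matrix.zero_mul, Matrix.mul_zero, add_zero, zero_add]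
  exact sub_mem (fromBlocks_mem_gMinus _ _) (fromBlocks_mem_gMinus _ _)

/-- Since `tr([y, X] Z) = tr([X, Z] y)` and `[X, Z]` is block diagonal, the orthogonal in `g(-1)` of
`[g(1), X]` is `g(-1)^X`; rank-nullity for `y ↦ [y, X]` does the rest. -/
theorem finrank_stabilizer_add [CharZero K] {X : Mat K p q} (hX : X ∈ gMinus K p q) :
    Module.finrank K (stabilizer X) + 2 * (p * q) =
      Module.finrank K (centralizerMinus X) + (p * p + q * q) := by
  let f : (Coord p q → K) →ₗ[K] gMinus K p q :=
    LinearMap.codRestrict _ ((LinearMap.mulRight K X - LinearMap.mulLeft K X) ∘ₗ blk)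
      (blk_commutator_mem hX)
  have h1 := LinearMap.finrank_range_add_finrank_ker f
  have h2 : LinearMap.ker f = stabilizer X := LinearMap.ker_codRestrict _ _ _
  have h3 := LinearMap.BilinForm.finrank_orthogonal
    (traceMinus_nondegenerate (K := K) (p := p) (q := q)) (LinearMap.range f)
  have h4 : (traceMinus K p q).orthogonal (LinearMap.range f) =
      (centralizerMinus X).comap (gMinus K p q).subtype := by
    ext Z
    rw [LinearMap.BilinForm.mem_orthogonal_iff, Submodule.mem_comap, mem_centralizerMinus]
    have h5 : ∀ y, traceMinus K p q (f y) Z = trace ((X * Z.1 - Z.1 * X) * blk y) := by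
      intro y
      change trace ((blk y * X - X * blk y) * Z.1) = _
      rw [Matrix.sub_mul, Matrix.sub_mul, trace_sub, trace_sub, trace_mul_cycle X,
        Matrix.mul_assoc, trace_mul_comm (blk y)]
    constructor
    · intro h
      refine ⟨Z.2, sub_eq_zero.mp (eq_zero_of_trace_mul_eq_zero fun W => ?_)⟩
      obtain ⟨w, hw⟩ := commutator_eq_blk hX Z.2
      rw [Submodule.subtype_apply, ← trace_mul_blk_coords hw, ← h5]
      exact h _ ⟨_, rfl⟩
    · rintro ⟨-, h⟩ _ ⟨y, rfl⟩
      have h6 : X * Z.1 - Z.1 * X = 0 := sub_eq_zero.mpr h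
      change traceMinus K p q (f y) Z = 0
      rw [h5, h6, Matrix.zero_mul, trace_zero]
  have h7 : Module.finrank K ((centralizerMinus X).comap (gMinus K p q).subtype) =
      Module.finrank K (centralizerMinus X) := by
    rw [← Submodule.finrank_map_subtype_eq, Submodule.map_comap_subtype,
      inf_eq_right.mpr fun _ h => (mem_centralizerMinus.mp h).1]
  rw [h4, h7, finrank_gMinus] at h3
  have h8 := Submodule.finrank_le (LinearMap.range f)
  rw [finrank_gMinus] at h8
  rw [h2] at h1
  have h9 : Module.finrank K (Coord p q → K) = p * p + q * q := by simp
  omega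

end Minus

end SymGL

/-! ### Openness of linear independence. -/

/-- Linear independence of a family of matrices with polynomial entries holds away from the
zeros of a polynomial, if it holds at one point. -/
theorem exists_polynomial_linearIndependent {K ι n : Type*} [Field K] [Finite ι]
    [Finite n] (v : ι → Matrix n n (Polynomial K)) (a : K)
    (h : LinearIndependent K fun i => (v i).map (Polynomial.eval a)) :
    ∃ P : Polynomial K, P ≠ 0 ∧ ∀ s, P.eval s ≠ 0 →
      LinearIndependent K fun i => (v i).map (Polynomial.eval s) := by
  classical
  have := Fintype.ofFinite ι
  have := Fintype.ofFinite n
  let V (s : K) : Matrix ι (n × n) K := Matrix.of fun i jk => (v i jk.1 jk.2).eval s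
  have hV (s : K) : LinearIndependent K (fun i => (v i).map (Polynomial.eval s)) ↔
      Function.Injective (V s).vecMul := by
    rw [Matrix.vecMul_injective_iff]
    exact (LinearMap.linearIndependent_iff (LinearEquiv.curry K K n n).toLinearMap
      (LinearEquiv.ker _) (v := (V s).row))
  rw [hV] at h
  have hker : LinearMap.ker (V a).vecMulLinear = ⊥ := LinearMap.ker_eq_bot.mpr h
  obtain ⟨g, hg⟩ := LinearMap.exists_leftInverse_of_injective _ hker
  let N : Matrix (n × n) ι K := Matrix.of fun jk i => g (Pi.single jk 1) i
  have hgN : ∀ w, g w = Matrix.vecMul w N := by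
    intro w
    conv_lhs => rw [pi_eq_sum_univ' w, map_sum]
    ext i
    simp [N, Matrix.vecMul, dotProduct]
  have hVN : V a * N = 1 := by
    apply Matrix.ext_of_single_vecMul
    intro i
    rw [← Matrix.vecMul_vecMul, ← hgN]
    simpa using LinearMap.congr_fun hg (Pi.single i 1)
  let VX : Matrix ι (n × n) (Polynomial K) := Matrix.of fun i jk => v i jk.1 jk.2
  -- `N` is a right inverse of `V a`, so `P` takes the value `1` at `a`; where `P` does not vanish,
  -- `V s * N` is invertible and the rows of `V s` are independent.
  let P : Polynomial K := (VX * N.map Polynomial.C).det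
  have hP (s : K) : P.eval s = (V s * N).det := by
    change Polynomial.evalRingHom s P = _
    rw [RingHom.map_det, RingHom.mapMatrix_apply, Matrix.map_mul, Matrix.map_map]
    congr 2
    ext
    simp
  refine ⟨P, fun h0 => ?_, fun s hs => (hV s).mpr ?_⟩
  · have := hP a
    rw [h0, hVN] at this
    simp at this
  · rw [hP] at hs
    intro x y hxy
    have h1 : Matrix.vecMul x (V s * N) = Matrix.vecMul y (V s * N) := by
      rw [← Matrix.vecMul_vecMul, ← Matrix.vecMul_vecMul]
      exact congrArg (Matrix.vecMul · N) hxy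
    exact Matrix.vecMul_injective_iff_isUnit.mpr
      ((Matrix.isUnit_iff_isUnit_det _).mpr (isUnit_iff_ne_zero.mpr hs)) h1

namespace SymGL

open Matrix

/-! ### The nilpotent element `e`. -/

section Nilpotent

variable (K : Type*) [Field K] {p q : ℕ}

theorem e_mem_gMinus (p q : ℕ) : e K p q ∈ gMinus K p q := fromBlocks_mem_gMinus _ _

theorem e_map {L : Type*} [Field L] (f : K →+* L) (p q : ℕ) : (e K p q).map f = e L p q := by
  ext (i | i) (j | j) <;> simp [e, apply_ite f]

variable {K}

theorem e_mul_inl {m : Type*} (M : Matrix (Fin p ⊕ Fin q) m K) (i : Fin p) (b : m) :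
    (e K p q * M) (.inl i) b = if h : (i : ℕ) < q then M (.inr ⟨i, h⟩) b else 0 := by
  simp only [Matrix.mul_apply, Fintype.sum_sum_type, e, fromBlocks_apply₁₁, fromBlocks_apply₁₂,
    of_apply, Matrix.zero_apply, zero_mul, Finset.sum_const_zero, zero_add, ite_mul, one_mul]
  split_ifs with h
  · rw [Finset.sum_eq_single ⟨i, h⟩] <;> simp +contextual [Fin.ext_iff, eq_comm]
  · exact Finset.sum_eq_zero fun j _ => if_neg (by omega)

theorem e_mul_inr {m : Type*} (M : Matrix (Fin p ⊕ Fin q) m K) (i : Fin q) (b : m) :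
    (e K p q * M) (.inr i) b = if h : (i : ℕ) + 1 < p then M (.inl ⟨i + 1, h⟩) b else 0 := by
  simp only [Matrix.mul_apply, Fintype.sum_sum_type, e, fromBlocks_apply₂₁, fromBlocks_apply₂₂,
    of_apply, Matrix.zero_apply, zero_mul, Finset.sum_const_zero, add_zero, ite_mul, one_mul]
  split_ifs with h
  · rw [Finset.sum_eq_single ⟨i + 1, h⟩] <;> simp +contextual [Fin.ext_iff]
  · exact Finset.sum_eq_zero fun j _ => if_neg (by omega)

theorem mul_e_inr {m : Type*} (hpq : q ≤ p) (M : Matrix m (Fin p ⊕ Fin q) K) (a : m) (j : Fin q) :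
    (M * e K p q) a (.inr j) = M a (.inl ⟨j, j.2.trans_le hpq⟩) := by
  simp only [Matrix.mul_apply, Fintype.sum_sum_type, e, fromBlocks_apply₂₂, fromBlocks_apply₁₂,
    of_apply, Matrix.zero_apply, mul_zero, Finset.sum_const_zero, add_zero, mul_ite, mul_one]
  rw [Finset.sum_eq_single ⟨j, j.2.trans_le hpq⟩] <;> simp +contextual [Fin.ext_iff]

theorem mul_e_inl_zero {m : Type*} (M : Matrix m (Fin p ⊕ Fin q) K) (a : m)
    (k : Fin p) (hk : (k : ℕ) = 0 ∨ q < k) : (M * e K p q) a (.inl k) = 0 := by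
  simp only [Matrix.mul_apply, Fintype.sum_sum_type, e, fromBlocks_apply₁₁, fromBlocks_apply₂₁,
    of_apply, Matrix.zero_apply, mul_zero, Finset.sum_const_zero, zero_add, mul_ite, mul_one]
  exact Finset.sum_eq_zero fun j _ => if_neg (by omega)

theorem mul_e_inl_succ {m : Type*} (M : Matrix m (Fin p ⊕ Fin q) K) (a : m)
    (j : Fin q) (hj : (j : ℕ) + 1 < p) :
    (M * e K p q) a (.inl ⟨j + 1, hj⟩) = M a (.inr j) := by
  simp only [Matrix.mul_apply, Fintype.sum_sum_type, e, fromBlocks_apply₁₁, fromBlocks_apply₂₁,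
    of_apply, Matrix.zero_apply, mul_zero, Finset.sum_const_zero, zero_add, mul_ite, mul_one]
  rw [Finset.sum_eq_single j] <;> simp +contextual [Fin.ext_iff, eq_comm]

/-- The position of a basis vector in its Jordan chain. -/
def level : Fin p ⊕ Fin q → ℕ := Sum.elim (fun i => 2 * i) (fun j => 2 * j + 1)

/-- Each application of `e` to a basis vector lowers the level by one or gives zero. -/
theorem e_pow_apply_eq_zero (n : ℕ) (a b : Fin p ⊕ Fin q) (h : level b ≠ level a + n) :
    (e K p q ^ n) a b = 0 := by
  induction n generalizing a with
  | zero =>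
    rw [pow_zero, Matrix.one_apply_ne]
    rintro rfl
    exact h rfl
  | succ n ih =>
    rw [pow_succ']
    rcases a with i | i
    · rw [e_mul_inl]
      split_ifs
      · refine ih _ fun h' => h ?_
        rw [h']
        simp [level]
        ring
      · rfl
    · rw [e_mul_inr]
      split_ifs
      · refine ih _ fun h' => h ?_
        rw [h']
        simp [level]
        ring
      · rfl

theorem isNilpotent_e : IsNilpotent (e K p q) := by
  refine ⟨2 * (p + q), ?_⟩
  ext a b
  refine e_pow_apply_eq_zero _ _ _ ?_
  have : level b < 2 * (p + q) := by
    rcases b with i | i <;> simp [level] <;> omega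
  omega

theorem e_pow_apply_eq_one (hpq : q ≤ p) (n j : ℕ) (hj : j + n < q) :
    (e K p q ^ (2 * n + 1)) (.inl ⟨j, by omega⟩) (.inr ⟨j + n, hj⟩) = 1 := by
  induction n generalizing j with
  | zero => simp [e]
  | succ n ih =>
    have h1 : e K p q ^ (2 * (n + 1) + 1) = e K p q * (e K p q * e K p q ^ (2 * n + 1)) := by
      rw [← pow_succ', ← pow_succ']
      ring_nf
    rw [h1, e_mul_inl, dif_pos (by simp; omega), e_mul_inr, dif_pos (by simp; omega)]
    have := ih (j + 1) (by omega)
    convert this using 3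
    simp
    omega

theorem linearIndependent_e_pow (hpq : q ≤ p) :
    LinearIndependent K fun i : Fin q => e K p q ^ (2 * (i : ℕ) + 1) := by
  rw [Fintype.linearIndependent_iff]
  intro g hg i
  -- The levels of this row and column differ by `2 * i + 1`, so only the `i`-th power has a nonzero
  -- entry here.
  have h1 := congrFun₂ hg (.inl ⟨q - 1 - i, by omega⟩) (.inr ⟨q - 1 - i + i, by omega⟩)
  rw [Matrix.sum_apply, Finset.sum_eq_single i] at h1
  · rw [Matrix.smul_apply, e_pow_apply_eq_one hpq _ _ (by omega)] at h1
    simpa using h1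
  · intro j _ hji
    rw [Matrix.smul_apply, e_pow_apply_eq_zero, smul_zero]
    simp only [level, Sum.elim_inl, Sum.elim_inr]
    have := Fin.val_ne_of_ne hji
    omega
  · simp

/-- Commuting with `e` makes each row of the upper right block, up to index `q`, the right shift of
the row above it, and kills the rows after that; the lower left block is then determined too. -/
theorem finrank_centralizerMinus_e_le [CharZero K] (hq : 0 < q) (hpq : q ≤ p) :
    Module.finrank K (centralizerMinus (e K p q)) ≤ q := by
  let f : centralizerMinus (e K p q) →ₗ[K] (Fin q → K) :=
    { toFun := fun X j => X.1 (.inl ⟨0, by omega⟩) (.inr j)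
      map_add' := fun X Y => rfl
      map_smul' := fun c X => rfl }
  have hf : Function.Injective f := by
    rw [injective_iff_map_eq_zero]
    rintro ⟨X, hX⟩ h0
    obtain ⟨hX1, hX2⟩ := mem_centralizerMinus.mp hX
    have hX2' : ∀ a b, (e K p q * X) a b = (X * e K p q) a b := fun a b => by rw [hX2]
    have hC : ∀ n (hn : n < p) (j : Fin q), X (.inl ⟨n, hn⟩) (.inr j) = 0 := by
      intro n
      induction n with
      | zero => exact fun _ j => congrFun h0 j
      | succ n ih =>
        intro hn j
        by_cases hnq : n < q
        · have h1 := hX2' (.inr ⟨n, hnq⟩) (.inr j)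
          rw [e_mul_inr, dif_pos hn, mul_e_inr hpq] at h1
          rw [h1]
          have h2 := hX2' (.inl ⟨n, by omega⟩) (.inl ⟨j, by omega⟩)
          rw [e_mul_inl, dif_pos hnq] at h2
          rw [h2]
          rcases j with ⟨_ | j, hj⟩
          · exact mul_e_inl_zero _ _ _ (.inl rfl)
          · exact (mul_e_inl_succ X _ ⟨j, by omega⟩ (by simp; omega)).trans (ih _ _)
        · have h1 := hX2' (.inl ⟨n + 1, hn⟩) (.inl ⟨j + 1, by omega⟩)
          rw [e_mul_inl, dif_neg (by simp; omega), mul_e_inl_succ] at h1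
          exact h1.symm
    have hD : ∀ (i : Fin q) (k : Fin p), X (.inr i) (.inl k) = 0 := by
      intro i k
      have h1 := hX2' (.inl ⟨i, by omega⟩) (.inl k)
      rw [e_mul_inl, dif_pos i.2] at h1
      rw [h1]
      rcases k with ⟨_ | k, hk⟩
      · exact mul_e_inl_zero _ _ _ (.inl rfl)
      · by_cases hkq : k < q
        · exact (mul_e_inl_succ X _ ⟨k, hkq⟩ hk).trans (hC _ _ _)
        · exact mul_e_inl_zero _ _ _ (.inr (by simp; omega))
    obtain ⟨C, D, rfl⟩ := mem_gMinus_iff.mp hX1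
    apply Subtype.ext
    ext (i | i) (j | j)
    · rfl
    · exact hC i i.2 j
    · exact hD i j
    · rfl
  simpa using LinearMap.finrank_le_finrank_of_injective hf

end Nilpotent

/-! ### The lower bound for centralizers and the maximality of the orbit of `e`. -/

theorem le_finrank_centralizerMinus {K : Type*} [Field K] [CharZero K] {p q : ℕ} (hpq : q ≤ p)
    {X : Mat K p q} (hX : X ∈ gMinus K p q) : q ≤ Module.finrank K (centralizerMinus X) := by
  -- The line that passes through `e` at `0` and through `X` at `1`.
  let L : Matrix (Fin p ⊕ Fin q) (Fin p ⊕ Fin q) (Polynomial K) :=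
    (e K p q).map Polynomial.C + (Polynomial.X : Polynomial K) • (X - e K p q).map Polynomial.C
  let Xs (s : K) : Mat K p q := e K p q + s • (X - e K p q)
  have hL (s : K) : L.map (Polynomial.evalRingHom s) = Xs s := by
    ext i j
    simp [L, Xs]
  have hXs (s : K) : Xs s ∈ gMinus K p q :=
    add_mem (e_mem_gMinus K p q) (Submodule.smul_mem _ _ (sub_mem hX (e_mem_gMinus K p q)))
  have hpow (s : K) (n : ℕ) : (L ^ n).map (Polynomial.eval s) = Xs s ^ n := by
    rw [← hL s]
    exact map_pow (Polynomial.evalRingHom s).mapMatrix L n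
  obtain ⟨P, hP, hPs⟩ := exists_polynomial_linearIndependent
    (fun i : Fin q => L ^ (2 * (i : ℕ) + 1)) 0 (by
      simpa only [hpow, Xs, zero_smul, add_zero] using linearIndependent_e_pow (K := K) hpq)
  have b := Module.finBasis K (LinearMap.range (adMinus X))
  have hb : LinearIndependent K fun i => (b i : Mat K p q) :=
    b.linearIndependent.map' (LinearMap.range (adMinus X)).subtype (Submodule.ker_subtype _)
  -- Preimages of a basis of the image of `ad X`: their images under `ad (Xs s)` stay independent
  -- for general `s`, so the rank at `X` is at most the rank at `Xs s`.
  choose u hu using fun i => (b i).2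
  have had (s : K) (i) : (L * (u i).1.map Polynomial.C - (u i).1.map Polynomial.C * L).map
      (Polynomial.eval s) = adMinus (Xs s) (u i) := by
    have hC : ((u i).1.map Polynomial.C).map (Polynomial.evalRingHom s) = (u i).1 := by
      ext
      simp
    rw [adMinus_apply, ← hL s]
    conv_rhs => rw [← hC, ← Matrix.map_mul, ← Matrix.map_mul]
    ext
    simp
  obtain ⟨Q, hQ, hQs⟩ := exists_polynomial_linearIndependent
    (fun i => L * (u i).1.map Polynomial.C - (u i).1.map Polynomial.C * L) 1 (by
      have h1 : Xs 1 = X := by simp [Xs]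
      simpa only [had, h1, hu] using hb)
  obtain ⟨s, hs⟩ := (P * Q).exists_eval_ne_zero_of_natDegree_lt_card (mul_ne_zero hP hQ)
    (Cardinal.natCast_lt_aleph0.trans_le (Cardinal.infinite_iff.mp inferInstance))
  rw [Polynomial.eval_mul] at hs
  have h1 : q ≤ Module.finrank K (centralizerMinus (Xs s)) := by
    have h2 := hPs s (left_ne_zero_of_mul hs)
    simp only [hpow] at h2
    let w : Fin q → centralizerMinus (Xs s) := fun i => ⟨Xs s ^ (2 * (i : ℕ) + 1),
      mem_centralizerMinus.mpr ⟨odd_pow_mem_gMinus (hXs s) i, (pow_mul_comm' _ _).symm⟩⟩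
    have h3 : LinearIndependent K w := LinearIndependent.of_comp (Submodule.subtype _) h2
    simpa using h3.fintype_card_le_finrank
  have h4 : Module.finrank K (LinearMap.range (adMinus X)) ≤
      Module.finrank K (LinearMap.range (adMinus (Xs s))) := by
    have h2 := hQs s (right_ne_zero_of_mul hs)
    simp only [had] at h2
    let w : Fin (Module.finrank K (LinearMap.range (adMinus X))) →
      LinearMap.range (adMinus (Xs s)) := fun i => ⟨_, u i, rfl⟩
    have h3 : LinearIndependent K w := LinearIndependent.of_comp (Submodule.subtype _) h2
    simpa using h3.fintype_card_le_finrank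
  have h5 := finrank_range_adMinus_add X
  have h6 := finrank_range_adMinus_add (Xs s)
  omega

theorem finrank_centralizerMinus_e (K : Type*) [Field K] [CharZero K] {p q : ℕ} (hq : 0 < q)
    (hpq : q ≤ p) : Module.finrank K (centralizerMinus (e K p q)) = q :=
  (finrank_centralizerMinus_e_le hq hpq).antisymm
    (le_finrank_centralizerMinus hpq (e_mem_gMinus K p q))

theorem orbitDim_le_orbitDim_e {K : Type*} [Field K] [CharZero K] {p q : ℕ} (hq : 0 < q)
    (hpq : q ≤ p) {Y : Mat K p q} (hY : Y ∈ gMinus K p q) : orbitDim Y ≤ orbitDim (e K p q) := by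
  obtain ⟨m, hm, hm'⟩ := orbitDim_eq Y
  obtain ⟨n, hn, hn'⟩ := orbitDim_eq (e K p q)
  have h1 := finrank_stabilizer_add hY
  have h2 := finrank_stabilizer_add (e_mem_gMinus K p q)
  have h3 := finrank_centralizerMinus_e K hq hpq
  have h4 := le_finrank_centralizerMinus hpq hY
  rw [hm, hn]
  have h5 : m ≤ n := by omega
  exact_mod_cast h5

end SymGL

/-! ### Commuting semisimple endomorphisms. -/

section EndLemmas

open Module

variable {K V : Type*} [Field K] [AddCommGroup V] [Module K V]

theorem Module.End.IsSemisimple.apply_eq_zero_of_apply_apply_eq_zero {f : End K V}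
    (hf : f.IsSemisimple) {v : V} (hv : f (f v) = 0) : f v = 0 := by
  have h := hf.isFinitelySemisimple.genEigenspace_eq_eigenspace 0 (k := 2) (by simp)
  have h1 : v ∈ f.genEigenspace 0 2 := by
    rw [show (2 : ℕ∞) = ((2 : ℕ) : ℕ∞) from rfl, End.mem_genEigenspace_nat]
    simpa [pow_two] using hv
  rw [h, End.mem_eigenspace_iff] at h1
  simpa using h1

variable [FiniteDimensional K V]

theorem Module.End.IsSemisimple.ker_sup_range {f : End K V} (hf : f.IsSemisimple) :
    LinearMap.ker f ⊔ LinearMap.range f = ⊤ := by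
  apply Submodule.eq_top_of_disjoint
  · rw [add_comm]
    exact (LinearMap.finrank_range_add_finrank_ker f).ge
  · rw [Submodule.disjoint_def]
    rintro _ hx ⟨v, rfl⟩
    exact hf.apply_eq_zero_of_apply_apply_eq_zero hx

theorem exists_smul_add_injOn_range [Infinite K] {f g : End K V} (hf : f.IsSemisimple)
    (hfg : Commute f g) :
    ∃ c : K, c ≠ 0 ∧ ∀ x ∈ LinearMap.range f, (f + c • g) x = 0 → x = 0 := by
  have hmf : ∀ x ∈ LinearMap.range f, f x ∈ LinearMap.range f := fun x _ => ⟨x, rfl⟩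
  have hmg : ∀ x ∈ LinearMap.range f, g x ∈ LinearMap.range f := by
    rintro _ ⟨y, rfl⟩
    exact ⟨g y, LinearMap.congr_fun hfg y⟩
  let fr : End K (LinearMap.range f) := f.restrict hmf
  let gr : End K (LinearMap.range f) := g.restrict hmg
  have hker : Function.Injective fr := by
    rw [injective_iff_map_eq_zero]
    rintro ⟨_, y, rfl⟩ h
    exact Subtype.ext (hf.apply_eq_zero_of_apply_apply_eq_zero (congrArg Subtype.val h))
  let fe : LinearMap.range f ≃ₗ[K] LinearMap.range f := LinearEquiv.ofInjectiveEndo fr hker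
  let z : End K (LinearMap.range f) := fe.symm.toLinearMap ∘ₗ gr
  -- On the range of `f`, where `f` is invertible, `(f - μ⁻¹ g) x = 0` says that `f⁻¹ g` has
  -- eigenvector `x` with eigenvalue `μ`; only finitely many `μ` are excluded.
  obtain ⟨μ, hμ⟩ := (z.finite_hasEigenvalue.union
    (Set.finite_singleton (0 : K))).infinite_compl.nonempty
  simp only [Set.compl_union, Set.mem_inter_iff, Set.mem_compl_iff, Set.mem_ofPred_eq,
    Set.mem_singleton_iff] at hμ
  obtain ⟨hμ1, hμ0⟩ := hμ
  refine ⟨-μ⁻¹, neg_ne_zero.mpr (inv_ne_zero hμ0), fun x hx h => ?_⟩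
  by_contra hx0
  refine hμ1 (End.hasEigenvalue_of_hasEigenvector (x := ⟨x, hx⟩)
    ⟨End.mem_eigenspace_iff.mpr ?_, fun h' => hx0 (congrArg Subtype.val h')⟩)
  have h1 : g x = μ • f x := by
    rw [LinearMap.add_apply, LinearMap.smul_apply, neg_smul] at h
    rw [add_neg_eq_zero.mp h, smul_inv_smul₀ hμ0]
  change fe.symm (gr ⟨x, hx⟩) = _
  rw [LinearEquiv.symm_apply_eq, map_smul]
  exact Subtype.ext h1

/-- Take `f` with kernel of least dimension. If `g` does not kill `ker f`, then for suitable `c` the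
kernel of `f + c g` is strictly smaller: `f z` lies in the range of `f` and is killed by `f + c g`
whenever `z` is. -/
theorem exists_minimal_ker [Infinite K] (T : Submodule K (End K V))
    (hcomm : ∀ f ∈ T, ∀ g ∈ T, Commute f g) (hss : ∀ f ∈ T, f.IsSemisimple) :
    ∃ f ∈ T, ∀ g ∈ T, LinearMap.ker f ≤ LinearMap.ker g := by
  let F : T → ℕ := fun f => finrank K (LinearMap.ker f.1)
  refine ⟨(Function.argmin F).1, (Function.argmin F).2, fun g hg v hv => ?_⟩
  set f := Function.argmin F with hf
  by_contra hgv
  obtain ⟨c, hc, hinj⟩ := exists_smul_add_injOn_range (hss f f.2) (hcomm f f.2 g hg)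
  have hle : LinearMap.ker (f.1 + c • g) ≤ LinearMap.ker f.1 := by
    intro z hz
    rw [LinearMap.mem_ker] at hz ⊢
    apply hinj _ ⟨z, rfl⟩
    have h1 : Commute f.1 (f.1 + c • g) :=
      (Commute.refl _).add_right ((hcomm f f.2 g hg).smul_right c)
    have h2 := LinearMap.congr_fun h1 z
    simp only [Module.End.mul_apply] at h2
    rw [← h2, hz, map_zero]
  have hlt : LinearMap.ker (f.1 + c • g) < LinearMap.ker f.1 := by
    refine lt_of_le_of_ne hle fun h => hgv ?_
    have h1 := h.symm ▸ hv
    rw [LinearMap.mem_ker, LinearMap.add_apply, hv, zero_add, LinearMap.smul_apply] at h1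
    exact (smul_eq_zero_iff_right hc).mp h1
  have h2 := Submodule.finrank_lt_finrank_of_lt hlt
  exact (Function.argmin_le F ⟨f.1 + c • g, add_mem f.2 (T.smul_mem c hg)⟩).not_gt h2

end EndLemmas

/-! ### Semisimplicity of `ad X` and traces of nilpotent matrices. -/

section MatrixLemmas

open Matrix

variable {K n : Type*} [Field K] [Fintype n] [DecidableEq n]

theorem isSemisimple_mulLeft {X : Matrix n n K} (hX : Module.End.IsSemisimple (toLin' X)) :
    Module.End.IsSemisimple (LinearMap.mulLeft K X) := by
  refine Module.End.isSemisimple_of_squarefree_aeval_eq_zero hX.minpoly_squarefree ?_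
  rw [Matrix.minpoly_toLin']
  have h := Polynomial.aeval_algHom_apply (Algebra.lmul K (Matrix n n K)) X (minpoly K X)
  rw [minpoly.aeval, map_zero] at h
  exact h

theorem isSemisimple_mulRight {X : Matrix n n K} (hX : Module.End.IsSemisimple (toLin' X)) :
    Module.End.IsSemisimple (LinearMap.mulRight K X) := by
  refine Module.End.isSemisimple_of_squarefree_aeval_eq_zero hX.minpoly_squarefree ?_
  rw [Matrix.minpoly_toLin']
  have h : ∀ P : Polynomial K, Polynomial.aeval (LinearMap.mulRight K X) P =
      LinearMap.mulRight K (Polynomial.aeval X P) := by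
    intro P
    induction P using Polynomial.induction_on' with
    | add P Q hP hQ => rw [map_add, map_add, hP, hQ]; ext1 Y; simp [Matrix.mul_add]
    | monomial k a =>
      ext1 Y
      simp [Polynomial.aeval_monomial, LinearMap.pow_mulRight, Algebra.algebraMap_eq_smul_one]
  rw [h, minpoly.aeval]
  ext1 Y
  simp

theorem isSemisimple_mulLeft_sub_mulRight [PerfectField K] {X : Matrix n n K}
    (hX : Module.End.IsSemisimple (toLin' X)) :
    Module.End.IsSemisimple (LinearMap.mulLeft K X - LinearMap.mulRight K X) :=
  (isSemisimple_mulLeft hX).sub_of_commute (LinearMap.commute_mulLeft_right X X)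
    (isSemisimple_mulRight hX)

theorem trace_eq_zero_of_isNilpotent {X : Matrix n n K} (hX : IsNilpotent X) : trace X = 0 :=
  (Matrix.isNilpotent_trace_of_isNilpotent hX).eq_zero

end MatrixLemmas

/-! ### Cartan subspaces. -/

namespace SymGL

open Matrix

variable {K : Type*} [Field K] {p q : ℕ}

theorem mulVec_eq_zero_of_mulVec_mulVec {X : Mat K p q}
    (hX : Module.End.IsSemisimple (Matrix.toLin' X)) {v : Fin p ⊕ Fin q → K}
    (hv : X *ᵥ (X *ᵥ v) = 0) : X *ᵥ v = 0 :=
  hX.apply_eq_zero_of_apply_apply_eq_zero hv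

/-- The elements of `t` killing the vector `w` of the first summand. -/
def annihilator (t : Submodule K (Mat K p q)) (w : Fin p → K) : Submodule K (Mat K p q) :=
  t ⊓ LinearMap.ker ((Matrix.mulVecBilin K K).flip (Sum.elim w (0 : Fin q → K)))

theorem mem_annihilator {t : Submodule K (Mat K p q)} {w : Fin p → K} {X : Mat K p q} :
    X ∈ annihilator t w ↔ X ∈ t ∧ X *ᵥ Sum.elim w 0 = 0 := Iff.rfl

theorem isToralSubspace_bot : IsToralSubspace (⊥ : Submodule K (Mat K p q)) where
  le_gMinus := bot_le
  commute := by
    rintro X rfl Y rfl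
    rfl
  semisimple := by
    rintro X rfl
    rw [map_zero]
    exact Module.End.isSemisimple_zero

theorem mem_gMinus_iff_signature {X : Mat K p q} : X ∈ gMinus K p q ↔
    (signature K p q : Mat K p q) * X = -X * signature K p q := by
  rw [gMinus, Module.End.mem_eigenspace_iff, neg_one_smul, ← Units.mul_inv_eq_iff_eq_mul]
  rfl

theorem exists_isCartanSubspace : ∃ t : Submodule K (Mat K p q), IsCartanSubspace t := by
  obtain ⟨t, ht, hmax⟩ := WellFounded.has_min (wellFounded_gt (α := Submodule K (Mat K p q)))
    {t | IsToralSubspace t} ⟨⊥, isToralSubspace_bot⟩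
  exact ⟨t, ht, fun s hs hts => by
    by_contra h
    exact hmax s hs (lt_of_le_not_ge hts h)⟩

variable [CharZero K]

/-- Otherwise `X ^ 2` kills the second summand, hence so does `X` by semisimplicity; then `X ^ 2`
kills the first summand as well, and `X = 0`. -/
theorem exists_mulVec_mulVec_ne_zero {X : Mat K p q} (hX : X ∈ gMinus K p q)
    (hss : Module.End.IsSemisimple (Matrix.toLin' X)) (h0 : X ≠ 0) :
    ∃ (y : Fin q → K) (u : Fin p → K),
      X *ᵥ Sum.elim 0 y = Sum.elim u 0 ∧ X *ᵥ Sum.elim u 0 ≠ 0 := by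
  obtain ⟨C, D, rfl⟩ := mem_gMinus_iff.mp hX
  have h1 (y : Fin q → K) :
      fromBlocks 0 C D 0 *ᵥ Sum.elim 0 y = Sum.elim (C *ᵥ y) (0 : Fin q → K) := by
    simp [fromBlocks_mulVec]
  have h2 (x : Fin p → K) :
      fromBlocks 0 C D 0 *ᵥ Sum.elim x 0 = Sum.elim (0 : Fin p → K) (D *ᵥ x) := by
    simp [fromBlocks_mulVec]
  by_contra! hcon
  have hC : ∀ y, C *ᵥ y = 0 := by
    intro y
    have h3 := mulVec_eq_zero_of_mulVec_mulVec hss (v := Sum.elim 0 y) (by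
      rw [h1]
      exact hcon y _ (h1 y))
    rw [h1] at h3
    ext i
    exact congrFun h3 (.inl i)
  have hD : ∀ x, D *ᵥ x = 0 := by
    intro x
    have h3 := mulVec_eq_zero_of_mulVec_mulVec hss (v := Sum.elim x 0) (by
      rw [h2, h1, hC]
      exact Sum.elim_zero_zero)
    rw [h2] at h3
    ext i
    exact congrFun h3 (.inr i)
  apply h0
  have hC0 : C = 0 := by
    apply Matrix.ext_of_mulVec_single
    intro i
    rw [hC, Matrix.zero_mulVec]
  have hD0 : D = 0 := by
    apply Matrix.ext_of_mulVec_single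
    intro i
    rw [hD, Matrix.zero_mulVec]
  rw [hC0, hD0, fromBlocks_zero]

/-- Take `w` with annihilator of least dimension. If `X ≠ 0` kills `w`, choose `u = X y` with `X u ≠
0`. For `S` in `t` killing `w + u`, `S w = -X S y` is killed by `X`, so `X ^ 2` kills `S y` and `S w
= 0`. As `X` does not kill `w + u`, the annihilator has shrunk. -/
theorem exists_annihilator_eq_bot {t : Submodule K (Mat K p q)} (ht : IsToralSubspace t) :
    ∃ w, annihilator t w = ⊥ := by
  let F : (Fin p → K) → ℕ := fun w => Module.finrank K (annihilator t w)
  refine ⟨Function.argmin F, (Submodule.eq_bot_iff _).mpr fun X hX => ?_⟩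
  set w := Function.argmin F with hw
  by_contra hX0
  obtain ⟨hXt, hXw⟩ := mem_annihilator.mp hX
  obtain ⟨y, u, hu, hu0⟩ :=
    exists_mulVec_mulVec_ne_zero (ht.le_gMinus hXt) (ht.semisimple X hXt) hX0
  have hadd : (Sum.elim (w + u) 0 : Fin p ⊕ Fin q → K) = Sum.elim w 0 + Sum.elim u 0 := by
    ext (i | i) <;> simp
  have hle : annihilator t (w + u) ≤ annihilator t w := by
    intro S hS
    obtain ⟨hSt, hSw⟩ := mem_annihilator.mp hS
    refine mem_annihilator.mpr ⟨hSt, ?_⟩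
    have hcomm : ∀ v, S *ᵥ (X *ᵥ v) = X *ᵥ (S *ᵥ v) := by
      intro v
      rw [mulVec_mulVec, mulVec_mulVec, ht.commute S hSt X hXt]
    rw [hadd, mulVec_add, ← hu, hcomm, add_eq_zero_iff_eq_neg] at hSw
    have h1 : X *ᵥ (X *ᵥ (S *ᵥ Sum.elim 0 y)) = 0 := by
      rw [← neg_eq_zero, ← mulVec_neg, ← hSw, ← hcomm, hXw, mulVec_zero]
    rw [hSw, mulVec_eq_zero_of_mulVec_mulVec (ht.semisimple X hXt) h1, neg_zero]
  have hlt : annihilator t (w + u) < annihilator t w := by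
    refine lt_of_le_of_ne hle fun h => hu0 ?_
    rw [← h] at hX
    have h1 := (mem_annihilator.mp hX).2
    rwa [hadd, mulVec_add, hXw, zero_add] at h1
  exact (Function.argmin_le F (w + u)).not_gt (Submodule.finrank_lt_finrank_of_lt hlt)

theorem IsToralSubspace.finrank_le {t : Submodule K (Mat K p q)} (ht : IsToralSubspace t) :
    Module.finrank K t ≤ q := by
  obtain ⟨w, hw⟩ := exists_annihilator_eq_bot ht
  let f : t →ₗ[K] (Fin q → K) :=
    LinearMap.funLeft K K Sum.inr ∘ₗ
      (Matrix.mulVecBilin K K).flip (Sum.elim w (0 : Fin q → K)) ∘ₗ t.subtype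
  have hf : Function.Injective f := by
    rw [injective_iff_map_eq_zero]
    rintro ⟨X, hX⟩ h
    have h1 : X ∈ annihilator t w := by
      refine mem_annihilator.mpr ⟨hX, ?_⟩
      obtain ⟨C, D, rfl⟩ := mem_gMinus_iff.mp (ht.le_gMinus hX)
      ext (i | i)
      · simp [fromBlocks_mulVec]
      · exact congrFun h i
    rw [hw] at h1
    exact Subtype.ext h1
  simpa using LinearMap.finrank_le_finrank_of_injective hf

/-- A semisimple element of `g(-1)` commuting with a Cartan subspace belongs to it. -/
theorem IsCartanSubspace.mem_of_isSemisimple {t : Submodule K (Mat K p q)}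
    (ht : IsCartanSubspace t) {S : Mat K p q} (hS : S ∈ gMinus K p q)
    (hss : Module.End.IsSemisimple (Matrix.toLin' S)) (hcomm : ∀ X ∈ t, X * S = S * X) :
    S ∈ t := by
  have htor : IsToralSubspace (t ⊔ Submodule.span K {S}) := by
    refine ⟨sup_le ht.prop.le_gMinus (by simpa using hS), ?_, ?_⟩
    · intro X hX Y hY
      obtain ⟨X', hX', A, hA, rfl⟩ := Submodule.mem_sup.mp hX
      obtain ⟨Y', hY', B, hB, rfl⟩ := Submodule.mem_sup.mp hY
      obtain ⟨a, rfl⟩ := Submodule.mem_span_singleton.mp hA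
      obtain ⟨b, rfl⟩ := Submodule.mem_span_singleton.mp hB
      have h1 : Commute X' Y' := ht.prop.commute _ hX' _ hY'
      have h2 : Commute X' S := hcomm _ hX'
      have h3 : Commute S Y' := (hcomm _ hY').symm
      exact ((h1.add_right (h2.smul_right b)).add_left
        ((h3.add_right ((Commute.refl S).smul_right b)).smul_left a)).eq
    · intro X hX
      obtain ⟨X', hX', A, hA, rfl⟩ := Submodule.mem_sup.mp hX
      obtain ⟨a, rfl⟩ := Submodule.mem_span_singleton.mp hA
      rw [map_add, map_smul]
      refine Module.End.IsSemisimple.add_of_commute (Commute.smul_right ?_ a)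
        (ht.prop.semisimple _ hX') (Module.End.IsSemisimple_smul a hss)
      change toLin' X' ∘ₗ toLin' S = toLin' S ∘ₗ toLin' X'
      rw [← toLin'_mul, ← toLin'_mul, hcomm _ hX']
  exact ht.le_of_ge htor le_sup_left (Submodule.mem_sup_right (Submodule.mem_span_singleton_self S))

/-- The additive Jordan decomposition of an element of `g(-1)`. -/
theorem exists_jordan_decomposition {Y : Mat K p q} (hY : Y ∈ gMinus K p q) :
    ∃ N S : Mat K p q, Y = N + S ∧ IsNilpotent N ∧ S ∈ gMinus K p q ∧
      Module.End.IsSemisimple (Matrix.toLin' S) ∧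
      ∀ X : Mat K p q, X * Y = Y * X → X * S = S * X := by
  let φ : Mat K p q ≃ₐ[K] Module.End K (Fin p ⊕ Fin q → K) := Matrix.toLinAlgEquiv'
  obtain ⟨n, hn, s, hs, hnil, hss, hns⟩ := Module.End.exists_isNilpotent_isSemisimple (f := φ Y)
  have hcn : Commute n s := Algebra.commute_of_mem_adjoin_singleton_of_commute hs
    (Algebra.commute_of_mem_adjoin_self hn).symm
  let a := φ (signature K p q : Mat K p q)
  let b := φ ((signature K p q)⁻¹ : GL (Fin p ⊕ Fin q) K).val
  have hab : a * b = 1 := by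
    rw [← map_mul, Units.mul_inv, map_one]
  have hba : b * a = 1 := by
    rw [← map_mul, Units.inv_mul, map_one]
  have hconj (x y : Module.End K (Fin p ⊕ Fin q → K)) :
      -(a * x * b) * -(a * y * b) = a * (x * y) * b := by
    refine (neg_mul_neg (a * x * b) (a * y * b)).trans ?_
    calc a * x * b * (a * y * b) = a * x * (b * a) * y * b := by simp only [mul_assoc]
      _ = _ := by rw [hba, mul_one, mul_assoc a]
  have hnil' : IsNilpotent (-(a * n * b)) := by
    obtain ⟨k, hk⟩ := hnil
    have h1 : SemiconjBy a n (a * n * b) := by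
      rw [SemiconjBy, mul_assoc (a * n), hba, mul_one]
    have h2 := (h1.pow_right k).eq
    rw [hk, mul_zero] at h2
    refine IsNilpotent.neg ⟨k, ?_⟩
    rw [← mul_one ((a * n * b) ^ k), ← hab, ← mul_assoc, ← h2, zero_mul]
  have hss' : Module.End.IsSemisimple (-(a * s * b)) := by
    rw [Module.End.isSemisimple_neg]
    refine (LinearEquiv.isSemisimple_iff s (a * s * b)
      (LinearEquiv.ofLinearMap a b hab hba) ?_).mp hss
    change a * s = a * s * b * a
    rw [mul_assoc (a * s), hba, mul_one]
  have hYa : a * φ Y * b = -φ Y := by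
    rw [← map_mul, mem_gMinus_iff_signature.mp hY, ← map_mul, mul_assoc, Units.mul_inv, mul_one,
      map_neg]
  have hsum : n + s = -(a * n * b) + -(a * s * b) := by
    rw [← neg_add, ← add_mul, ← mul_add, ← hns, hYa]
    exact (neg_neg _).symm
  -- Applying `-θ` to the parts of `Y` gives another Jordan decomposition of `-θ(Y) = Y`; uniqueness
  -- puts the semisimple part in `g(-1)`.
  obtain ⟨-, hs'⟩ := Module.End.isNilpotent_isSemisimple_unique hnil hss hnil' hss' hcn
    (by rw [Commute, SemiconjBy, hconj, hconj, hcn.eq]) hsum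
  have hsS : φ (φ.symm s) = s := φ.apply_symm_apply s
  refine ⟨φ.symm n, φ.symm s, ?_, ?_, ?_, ?_, ?_⟩
  · rw [← map_add, ← hns, φ.symm_apply_apply]
  · exact hnil.map φ.symm
  · rw [mem_gMinus_iff_signature]
    apply φ.injective
    rw [map_mul, map_mul, map_neg, hsS]
    change a * s = -s * a
    conv_rhs => rw [hs']
    rw [neg_neg, mul_assoc (a * s), hba, mul_one]
  · change Module.End.IsSemisimple (φ (φ.symm s))
    rwa [hsS]
  · intro X hX
    have h1 : Commute (φ X) (φ Y) := by
      rw [Commute, SemiconjBy, ← map_mul, hX, map_mul]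
    apply φ.injective
    rw [map_mul, map_mul, hsS]
    exact Algebra.commute_of_mem_adjoin_singleton_of_commute hs h1

/-- An element of `t` whose `ad` has minimal kernel has the same centralizer as all of `t`. -/
theorem IsCartanSubspace.exists_forall_commute {t : Submodule K (Mat K p q)}
    (ht : IsCartanSubspace t) :
    ∃ X ∈ t, ∀ Y ∈ t, ∀ Z : Mat K p q, X * Z = Z * X → Y * Z = Z * Y := by
  let ad : Mat K p q →ₗ[K] Module.End K (Mat K p q) :=
    LinearMap.mul K (Mat K p q) - (LinearMap.mul K (Mat K p q)).flip
  have had (X Z : Mat K p q) : ad X Z = X * Z - Z * X := rfl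
  obtain ⟨_, ⟨X, hX, rfl⟩, hmin⟩ := exists_minimal_ker (t.map ad) (by
    rintro _ ⟨X, hX, rfl⟩ _ ⟨Y, hY, rfl⟩
    have h := ht.prop.commute X hX Y hY
    refine LinearMap.ext fun Z => ?_
    simp only [Module.End.mul_apply, had, mul_sub, sub_mul]
    rw [← mul_assoc X Y, h, mul_assoc Z X, h]
    simp only [mul_assoc]
    abel) (by
    rintro _ ⟨X, hX, rfl⟩
    exact isSemisimple_mulLeft_sub_mulRight (ht.prop.semisimple X hX))
  refine ⟨X, hX, fun Y hY Z hZ => ?_⟩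
  have h1 := hmin (ad Y) ⟨Y, hY, rfl⟩ (x := Z) (by
    rw [LinearMap.mem_ker, had, hZ, sub_self])
  rwa [LinearMap.mem_ker, had, sub_eq_zero] at h1

/-- The trace form is nondegenerate on the centralizer in `g(-1)` of a semisimple element. -/
theorem eq_zero_of_trace_mul_centralizerMinus {X : Mat K p q} (hX : X ∈ gMinus K p q)
    (hss : Module.End.IsSemisimple (Matrix.toLin' X)) {Y : Mat K p q}
    (hY : Y ∈ centralizerMinus X) (h : ∀ Z ∈ centralizerMinus X, trace (Y * Z) = 0) : Y = 0 := by
  obtain ⟨hY1, hY2⟩ := mem_centralizerMinus.mp hY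
  apply eq_zero_of_trace_mul_eq_zero
  intro W
  have hW : W ∈ (⊤ : Submodule K (Mat K p q)) := trivial
  -- Every matrix is a sum of one commuting with `X` and one in the image of `ad X`; the latter is
  -- orthogonal to `Y`.
  rw [← (isSemisimple_mulLeft_sub_mulRight hss).ker_sup_range] at hW
  obtain ⟨W₀, hW₀, _, ⟨U, rfl⟩, rfl⟩ := Submodule.mem_sup.mp hW
  have hW₀' : X * W₀ = W₀ * X := by
    simpa [sub_eq_zero] using hW₀
  have h1 : trace (Y * W₀) = 0 := by
    rw [← trace_mul_minusPart hY1]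
    exact h _ (mem_centralizerMinus.mpr ⟨minusPart_mem _, commute_minusPart hX hW₀'⟩)
  have h2 : trace (Y * (X * U - U * X)) = 0 := by
    rw [mul_sub, trace_sub, ← mul_assoc, ← mul_assoc, trace_mul_comm (Y * U), ← mul_assoc, hY2,
      sub_self]
  rw [mul_add, trace_add, h1, zero_add]
  exact h2

/-- For `X` with the same centralizer as `t`, maximality puts the semisimple part of each element of
`g(-1)^X` in `t`. Nilpotent elements of `g(-1)^X` are orthogonal to `t` and to each other, so
nondegeneracy of the trace form there makes them zero. -/
theorem IsCartanSubspace.exists_eq_centralizerMinus {t : Submodule K (Mat K p q)}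
    (ht : IsCartanSubspace t) : ∃ X ∈ t, t = centralizerMinus X := by
  obtain ⟨X, hXt, hX⟩ := ht.exists_forall_commute
  have hXm := ht.prop.le_gMinus hXt
  have hXs := ht.prop.semisimple X hXt
  refine ⟨X, hXt, le_antisymm (fun Y hY => mem_centralizerMinus.mpr
    ⟨ht.prop.le_gMinus hY, ht.prop.commute X hXt Y hY⟩) fun Y hY => ?_⟩
  have htle : t ≤ centralizerMinus X := fun Z hZ => mem_centralizerMinus.mpr
    ⟨ht.prop.le_gMinus hZ, ht.prop.commute X hXt Z hZ⟩
  have hdecomp : ∀ Z ∈ centralizerMinus X, ∃ N S, Z = N + S ∧ IsNilpotent N ∧ S ∈ t := by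
    intro Z hZ
    obtain ⟨hZ1, hZ2⟩ := mem_centralizerMinus.mp hZ
    obtain ⟨N, S, hNS, hN, hS, hSs, hSc⟩ := exists_jordan_decomposition hZ1
    exact ⟨N, S, hNS, hN, ht.mem_of_isSemisimple hS hSs fun T hT => hSc T (hX T hT Z hZ2)⟩
  have htrace : ∀ T ∈ t, ∀ N ∈ centralizerMinus X, IsNilpotent N → trace (T * N) = 0 := by
    intro T hT N hN hnil
    have hc : Commute T N := hX T hT N (mem_centralizerMinus.mp hN).2
    exact trace_eq_zero_of_isNilpotent (hc.isNilpotent_mul_left hnil)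
  have hnondeg : ∀ T ∈ t, (∀ T' ∈ t, trace (T * T') = 0) → T = 0 := by
    intro T hT hT'
    refine eq_zero_of_trace_mul_centralizerMinus hXm hXs (htle hT) fun Z hZ => ?_
    obtain ⟨N, S, rfl, hN, hS⟩ := hdecomp Z hZ
    have hNz : N ∈ centralizerMinus X := by
      simpa using sub_mem hZ (htle hS)
    rw [mul_add, trace_add, htrace T hT N hNz hN, hT' S hS, add_zero]
  -- The semisimple part of `N + N'` lies in `t` and is orthogonal to `t`, so it vanishes.
  have hnil_add : ∀ N ∈ centralizerMinus X, IsNilpotent N → ∀ N' ∈ centralizerMinus X,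
      IsNilpotent N' → IsNilpotent (N + N') := by
    intro N hN hNn N' hN' hNn'
    obtain ⟨N₁, S, h, hN₁, hS⟩ := hdecomp (N + N') (add_mem hN hN')
    have hN₁z : N₁ ∈ centralizerMinus X := by
      have := sub_mem (add_mem hN hN') (htle hS)
      rwa [h, add_sub_cancel_right] at this
    have hS0 : S = 0 := by
      refine hnondeg S hS fun T hT => ?_
      have h1 := congrArg (fun M => trace (T * M)) h
      simp only [mul_add, trace_add] at h1
      rw [htrace T hT N hN hNn, htrace T hT N' hN' hNn', htrace T hT N₁ hN₁z hN₁] at h1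
      rw [trace_mul_comm]
      simpa using h1.symm
    rw [h, hS0, add_zero]
    exact hN₁
  obtain ⟨N, S, rfl, hN, hS⟩ := hdecomp Y hY
  have hNz : N ∈ centralizerMinus X := by
    simpa using sub_mem hY (htle hS)
  suffices hN0 : N = 0 by rwa [hN0, zero_add]
  refine eq_zero_of_trace_mul_centralizerMinus hXm hXs hNz fun Z hZ => ?_
  obtain ⟨N', S', rfl, hN', hS'⟩ := hdecomp Z hZ
  have hNz' : N' ∈ centralizerMinus X := by
    simpa using sub_mem hZ (htle hS')
  have hsq : ∀ M : Mat K p q, IsNilpotent M → trace (M * M) = 0 := fun M hM =>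
    trace_eq_zero_of_isNilpotent ((Commute.refl M).isNilpotent_mul_left hM)
  -- Polarization: `N`, `N'` and `N + N'` all have square of trace zero, so `2 tr(N N') = 0`.
  have h1 := hsq _ (hnil_add N hNz hN N' hNz' hN')
  rw [add_mul, mul_add, mul_add, trace_add, trace_add, trace_add, hsq N hN, hsq N' hN',
    trace_mul_comm N' N, zero_add, add_zero, ← two_mul] at h1
  rw [mul_add, trace_add, trace_mul_comm N S', htrace S' hS' N hNz hN, add_zero]
  exact (mul_eq_zero_iff_left two_ne_zero).mp h1

theorem hasRank (K : Type*) [Field K] [CharZero K] {p q : ℕ} (hpq : q ≤ p) : HasRank K p q q := by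
  refine ⟨exists_isCartanSubspace, fun t ht => ht.prop.finrank_le.antisymm ?_⟩
  obtain ⟨X, hXt, hX⟩ := ht.exists_eq_centralizerMinus
  rw [hX]
  exact le_finrank_centralizerMinus hpq (ht.prop.le_gMinus hXt)

end SymGL

theorem mainTheorem5 {F : Type*} [Field F] [CharZero F]
    {Fbar : Type*} [Field Fbar] [Algebra F Fbar] [IsAlgClosure F Fbar]
    (p q : ℕ) (hq : 0 < q) (hpq : q ≤ p) :
    SymGL.e F p q ∈ SymGL.gMinus F p q ∧
    IsNilpotent (SymGL.e F p q) ∧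
    Module.finrank F (SymGL.centralizerMinus (SymGL.e F p q)) = q ∧
    SymGL.HasRank F p q q ∧
    SymGL.IsRelativelyRegular Fbar (SymGL.e F p q) := by
  have : CharZero Fbar := charZero_of_injective_algebraMap (algebraMap F Fbar).injective
  refine ⟨SymGL.e_mem_gMinus F p q, SymGL.isNilpotent_e,
    SymGL.finrank_centralizerMinus_e F hq hpq, SymGL.hasRank F hpq, ?_⟩
  rw [SymGL.IsRelativelyRegular, SymGL.e_map]
  exact ⟨SymGL.e_mem_gMinus Fbar p q, fun Y hY => SymGL.orbitDim_le_orbitDim_e hq hpq hY⟩
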